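/- Let $\mathcal X\subset\mathbb R^{d}$ be compact, let $k:\mathcal X\times\mathcal X\to\mathbb R$ be a (measurable) positive semidefinite kernel with $k(x,x)\le 1$ for all $x$, and let $\mathcal H_k$ be its reproducing kernel Hilbert space, $\phi(x)=k(x,\cdot)$. Let $s(a)=(1+e^{-a})^{-1}$, $\dot s=s(1-s)$, $\lambda>0$, $0<\delta<1$, and let $f\in\mathcal H_k$ with $\|f\|_k\le B$. Let $x_1,y_1,x_2,y_2,\dots$ be random, with $x_t\in\mathcal X$ and $y_t\in\{0,1\}$, such that for every $t\ge 1$ almost surely \[ \mathbb P\left(y_t=1\mid x_1,\dots,x_t,y_1,\dots,y_{t-1}\right)=s(f(x_t)). \] Put $\kappa=\sup_{|a|\le B}1/\dot s(a)$ and $L=\sup_{|a|\le B}\dot s(a)$. For $t\ge 0$ let $K_t=(k(x_i,x_j))_{i,j\le t}$, $k_t(x)=(k(x_1,x),\dots,k(x_t,x))$, \[ \sigma_t^2(x)=k(x,x)-k_t(x)^\top(K_t+\lambda\kappa I_t)^{-1}k_t(x),\qquad \gamma_t=\sup_{z_1,\dots,z_t\in\mathcal X}\tfrac12\log\det\left(I_t+(\lambda\kappa)^{-1}(k(z_i,z_j))_{i,j\le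 t}\right), \] \[ \beta_t(\delta)=4LB+2L\sqrt{\tfrac{2\kappa}{\lambda}\left(\gamma_t+\log\tfrac1\delta\right)}. \] Let $f_t$ be the minimizer over $h\in\mathcal H_k$ of \[ \mathcal L_t(h)=\sum_{\tau=1}^t\left(-y_\tau\log s(h(x_\tau))-(1-y_\tau)\log(1-s(h(x_\tau)))\right)+\tfrac\lambda2\|h\|_k^2 . \] With $g_t(h)=\sum_{\tau\le t}s(h(x_\tau))\phi(x_\tau)+\lambda h$, $V_t=\sum_{\tau\le t}\phi(x_\tau)\phi(x_\tau)^\top+\lambda\kappa I$, $\|v\|_{V_t}^2=\langle v,V_tv\rangle$ and $\|v\|_{V_t^{-1}}^2=\langle v,V_t^{-1}v\rangle$, a projected estimator is any \[ f_t^P\in\operatorname*{arg\,min}_{\|h\|_k\le B}\|g_t(h)-g_t(f_t)\|_{V_t^{-1}}, \] and let \[ \mathcal E_t(\delta)=\left\{h\in\mathcal H_k:\ \|h\|_k\le B,\ \|h-f_t^P\|_{V_t}\le 2\sqrt{\lambda\kappa}\,B+\kappa\sqrt{2\log\tfrac1\delta+2\gamma_t}\right\}. \] Then, for every realization of the data and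 every $t\ge0$, the minimizer $f_t$ exists and is unique and a projected estimator exists. Moreover, with probability at least $1-\delta$, simultaneously for all $t\ge0$, all $x\in\mathcal X$ and every choice of the projected estimator $f_t^P$, \[ |s(f_t^P(x))-s(f(x))|\le\beta_t(\delta)\,\sigma_t(x)\qquad\text{and}\qquad |s(h(x))-s(f(x))|\le\beta_t(\delta)\,\sigma_t(x)\ \text{ for all } h\in\mathcal E_t(\delta), \] and, on the same event, $|s(f_t(x))-s(f(x))|\le\beta_t(\delta)\,\sigma_t(x)$ for all $x\in\mathcal X$ and all $t\geq 0$ with $\|f_t\|_k\le B$. -/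

import Mathlib

open MeasureTheory ProbabilityTheory

noncomputable section

namespace LogisticCS

/-- The derivative `s'(a) = s(a) (1 - s(a))` of the sigmoid `s(a) = (1 + e^{-a})⁻¹`. -/
def sigmoidDot (a : ℝ) : ℝ := Real.sigmoid a * (1 - Real.sigmoid a)

/-- `κ = sup_{|a| ≤ B} 1 / s'(a)`. -/
def kappa (B : ℝ) : ℝ := sSup ((fun a => 1 / sigmoidDot a) '' Set.Icc (-B) B)

/-- `L = sup_{|a| ≤ B} s'(a)`. -/
def lip (B : ℝ) : ℝ := sSup (sigmoidDot '' Set.Icc (-B) B)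

section RKHS

variable {α : Type*} (H : Type*) [NormedAddCommGroup H] [InnerProductSpace ℝ H]
  [CompleteSpace H] [RKHS ℝ H α ℝ]

/-- The feature vector `φ(x) = k(x, ·)`, an element of the Hilbert space. -/
def feature (x : α) : H := RKHS.kerFun H x 1

/-- The scalar reproducing kernel `k` of the space `H` of real functions on `α`. -/
def kern (x x' : α) : ℝ := RKHS.kernel H x x' 1

/-- The kernel matrix `(k(x_i, x_j))_{i,j}` of the points `x_1, …, x_t`. -/
def gram {t : ℕ} (x : Fin t → α) : Matrix (Fin t) (Fin t) ℝ :=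
  Matrix.of fun i j => kern H (x i) (x j)

/-- The vector `k_t(z) = (k(x_1, z), …, k(x_t, z))`. -/
def kernVec {t : ℕ} (x : Fin t → α) (z : α) : Fin t → ℝ := fun i => kern H (x i) z

/-- `σ_t(z)`, with `σ_t(z)² = k(z, z) - k_t(z)ᵀ (K_t + λ κ I)⁻¹ k_t(z)`. -/
def postStd (B lam : ℝ) {t : ℕ} (x : Fin t → α) (z : α) : ℝ :=
  Real.sqrt (kern H z z -
    kernVec H x z ⬝ᵥ
      (gram H x + (lam * kappa B) • (1 : Matrix (Fin t) (Fin t) ℝ))⁻¹.mulVec (kernVec H x z))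

/-- `γ_t = sup_{x_1, …, x_t} ½ log det (I + (λ κ)⁻¹ K_t)`. -/
def infoGain (B lam : ℝ) (t : ℕ) : ℝ :=
  ⨆ x : Fin t → α,
    (1 / 2) * Real.log ((1 : Matrix (Fin t) (Fin t) ℝ) + (lam * kappa B)⁻¹ • gram H x).det

/-- `β_t(δ) = 4 L B + 2 L √((2 κ / λ) (γ_t + log (1 / δ)))`. -/
def betaCoef (B lam δ : ℝ) (t : ℕ) : ℝ :=
  4 * lip B * B +
    2 * lip B * Real.sqrt (2 * kappa B / lam * (infoGain H B lam t + Real.log (1 / δ)))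

variable {H}

/-- The regularized negative log-likelihood of `h` for the data `(x_1, y_1), …, (x_t, y_t)`. -/
def logisticLoss (lam : ℝ) {t : ℕ} (x : Fin t → α) (y : Fin t → ℝ) (h : H) : ℝ :=
  (∑ i, (-(y i) * Real.log (Real.sigmoid (h (x i)))
      - (1 - y i) * Real.log (1 - Real.sigmoid (h (x i)))))
    + lam / 2 * ‖h‖ ^ 2

/-- `h` is the kernelized logistic estimator: a minimizer of the loss over all of `H`. -/
def IsLogisticEstimator (lam : ℝ) {t : ℕ} (x : Fin t → α) (y : Fin t → ℝ) (h : H) : Prop :=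
  ∀ h' : H, logisticLoss lam x y h ≤ logisticLoss lam x y h'

/-- `g_t(h) = ∑_τ s(h(x_τ)) φ(x_τ) + λ h`. -/
def gradMap (lam : ℝ) {t : ℕ} (x : Fin t → α) (h : H) : H :=
  (∑ i, Real.sigmoid (h (x i)) • feature H (x i)) + lam • h

variable (H) in
/-- `V_t = S_t + λ κ I` with `S_t = ∑_τ φ(x_τ) φ(x_τ)ᵀ`. -/
def covOp (B lam : ℝ) {t : ℕ} (x : Fin t → α) : H →L[ℝ] H :=
  (∑ i, (innerSL ℝ (feature H (x i))).smulRight (feature H (x i)))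
    + (lam * kappa B) • ContinuousLinearMap.id ℝ H

/-- `‖v‖_{V_t} = √⟨v, V_t v⟩`. -/
def normV (B lam : ℝ) {t : ℕ} (x : Fin t → α) (v : H) : ℝ :=
  Real.sqrt (inner ℝ v (covOp H B lam x v))

/-- `‖v‖_{V_t⁻¹} = √⟨v, V_t⁻¹ v⟩`. -/
def normVinv (B lam : ℝ) {t : ℕ} (x : Fin t → α) (v : H) : ℝ :=
  Real.sqrt (inner ℝ v ((covOp H B lam x).inverse v))

/-- `p` is a projection of the estimator `h` into the ball of radius `B`: a minimizer of
`‖g_t(q) - g_t(h)‖_{V_t⁻¹}` over all `q` with `‖q‖ ≤ B`. -/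
def IsProjectedEstimator (B lam : ℝ) {t : ℕ} (x : Fin t → α) (h p : H) : Prop :=
  ‖p‖ ≤ B ∧ ∀ q : H, ‖q‖ ≤ B →
    normVinv B lam x (gradMap lam x p - gradMap lam x h) ≤
      normVinv B lam x (gradMap lam x q - gradMap lam x h)

/-- The confidence set around the projected estimator `p`: all `h` with `‖h‖ ≤ B` and
`‖h - p‖_{V_t} ≤ 2 √(λ κ) B + κ √(2 log (1 / δ) + 2 γ_t)`. -/
def confSet (B lam δ : ℝ) {t : ℕ} (x : Fin t → α) (p : H) : Set H :=
  {h | ‖h‖ ≤ B ∧ normV B lam x (h - p) ≤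
    2 * Real.sqrt (lam * kappa B) * B +
      kappa B * Real.sqrt (2 * Real.log (1 / δ) + 2 * infoGain H B lam t)}

end RKHS

/-- The information available when the feedback `y_t` is drawn: the σ-algebra generated by the
actions up to and including time `t` and the feedback strictly before time `t`. -/
abbrev history {Ω α : Type*} [MeasurableSpace α] (x : ℕ → Ω → α) (y : ℕ → Ω → ℝ) (t : ℕ) :
    MeasurableSpace Ω :=
  (⨆ i ≤ t, MeasurableSpace.comap (x i) inferInstance) ⊔
    (⨆ i < t, MeasurableSpace.comap (y i) inferInstance)

end LogisticCS

end

open LogisticCS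

namespace LogisticCS

/-! ### Scalar inequalities -/

/-! Put `ε_τ = y_τ - s(f(x_τ))` and `S_t = ∑ ε_τ φ(x_τ)`. The proof separates a probabilistic bound
on `‖S_t‖` in the `V_t⁻¹` norm from a deterministic argument.

Probability: by Hoeffding's lemma `2 ε_τ` is conditionally 1-subgaussian, so the method of mixtures
applies. Instead of a Gaussian measure on `H`, the mixture is built one observation at a time:
`mixtureStep` averages `exp(θ e - θ²/2)` over a real `θ ~ N(b, a)`, where `a`, `b` are the
predictive variance and mean given the past, and its conditional expectation is at most one
(`mixtureStep_bernoulli_le`). The Sherman–Morrison formula and a Schur complement make the product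
telescope to `exp(‖2 S_t‖² / 2) / √det(I + (λκ)⁻¹ K_t)` (`prod_mixtureStep_eq`). Ville's inequality
at level `1/δ` then bounds `2 ‖S_t‖²` by `log (1/δ) + γ_t` for all `t` at once.

Determinism: the first-order condition reads `g_t(f_t) = ∑ y_τ φ(x_τ)`, whence `g_t(f_t) - g_t(f) =
S_t - λ f`. Since `f` competes in the projection, passing to `f_t^P` costs a factor two. On `[-B,
B]` the sigmoid has slope at least `1/κ`, so `‖p - q‖_V ≤ κ ‖g_t(p) - g_t(q)‖_{V⁻¹}` on the ball
(`normV_sub_le_kappa_mul`); thus `f` lies within the radius of `ℰ_t` around `f_t^P`, and any other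
member within twice that radius of `f`. Duality of the two norms and `σ_t(z) = √(λκ) ‖φ(z)‖_{V⁻¹}`
turn this into the pointwise bound. -/

lemma bernoulli_exp_le {p : ℝ} (hp0 : 0 ≤ p) (hp1 : p ≤ 1) (θ : ℝ) :
    p * Real.exp (θ * (1 - p)) + (1 - p) * Real.exp (θ * (0 - p)) ≤ Real.exp (θ ^ 2 / 8) := by
  -- The Bernoulli law lives on an interval of length one, so Hoeffding's lemma gives variance proxy
  -- `1/4`, hence `θ² / 8`.
  set μ : Measure ℝ := ENNReal.ofReal p • Measure.dirac 1 + ENNReal.ofReal (1 - p) • Measure.dirac 0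
    with hμ
  have hprob : IsProbabilityMeasure μ := ⟨by
    simp [hμ, ← ENNReal.ofReal_add hp0 (sub_nonneg.2 hp1)]⟩
  have key (g : ℝ → ℝ) : ∫ a, g a ∂μ = p * g 1 + (1 - p) * g 0 := by
    rw [hμ, integral_add_measure, integral_smul_measure, integral_smul_measure, integral_dirac,
      integral_dirac, ENNReal.toReal_ofReal hp0, ENNReal.toReal_ofReal (sub_nonneg.2 hp1)]
    · simp
    · exact (integrable_dirac (by simp)).smul_measure (by simp)
    · exact (integrable_dirac (by simp)).smul_measure (by simp)
  have hmem : ∀ᵐ a ∂μ, id a ∈ Set.Icc (0 : ℝ) 1 := by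
    rw [hμ, ae_add_measure_iff]
    constructor <;> refine Measure.ae_smul_measure ?_ _ <;>
      rw [ae_dirac_eq] <;> simp
  have h := (hasSubgaussianMGF_of_mem_Icc (μ := μ) aemeasurable_id hmem).mgf_le θ
  rw [mgf, key, key] at h
  simp only [id, mul_one, mul_zero, add_zero] at h
  refine h.trans (le_of_eq ?_)
  congr 1
  simp
  ring

lemma exp_quadratic_eq {A : ℝ} (hA : 0 < A) (C D g : ℝ) :
    Real.exp (-A * g ^ 2 + C * g + D) =
      Real.exp (-A * (g - C / (2 * A)) ^ 2) * Real.exp (D + C ^ 2 / (4 * A)) := by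
  rw [← Real.exp_add]
  congr 1
  field_simp
  ring

lemma integrable_exp_quadratic {A : ℝ} (hA : 0 < A) (C D : ℝ) :
    Integrable fun g : ℝ => Real.exp (-A * g ^ 2 + C * g + D) := by
  simp_rw [exp_quadratic_eq hA C D]
  exact ((integrable_exp_neg_mul_sq hA).comp_sub_right _).mul_const _

lemma integral_exp_quadratic {A : ℝ} (hA : 0 < A) (C D : ℝ) :
    ∫ g : ℝ, Real.exp (-A * g ^ 2 + C * g + D) =
      Real.sqrt (Real.pi / A) * Real.exp (D + C ^ 2 / (4 * A)) := by
  simp_rw [exp_quadratic_eq hA C D, integral_mul_const]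
  rw [integral_sub_right_eq_self (fun g => Real.exp (-A * g ^ 2)), integral_gaussian]

/-- The factor by which the Gaussian mixture of exponential martingales grows when noise `e` is
observed at a point with predictive variance `a` and predictive mean `b`. -/
noncomputable def mixtureStep (a b e : ℝ) : ℝ :=
  Real.exp ((a * e ^ 2 + 2 * b * e - b ^ 2) / (2 * (1 + a))) / Real.sqrt (1 + a)

lemma mixtureStep_pos {a : ℝ} (ha : 0 ≤ a) (b e : ℝ) : 0 < mixtureStep a b e := by
  unfold mixtureStep
  positivity

/-- The integrand is `exp(θ e - θ²/2)` at `θ = b + √a g`, times the unnormalized standard Gaussian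
density of `g`; this is the origin of `mixtureStep`. -/
lemma integral_eq_mixtureStep {a : ℝ} (ha : 0 ≤ a) (b e : ℝ) :
    ∫ g : ℝ, Real.exp (-((1 + a) / 2) * g ^ 2 + (Real.sqrt a * (e - b)) * g + (b * e - b ^ 2 / 2)) =
      Real.sqrt (2 * Real.pi) * mixtureStep a b e := by
  have hs : Real.sqrt (Real.pi / ((1 + a) / 2)) = Real.sqrt (2 * Real.pi) / Real.sqrt (1 + a) := by
    rw [← Real.sqrt_div (by positivity)]
    congr 1
    field_simp
  rw [integral_exp_quadratic (by positivity), mixtureStep, hs, div_mul_eq_mul_div, mul_div_assoc]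
  congr 3
  rw [mul_pow, Real.sq_sqrt ha]
  field_simp
  ring

/-- Under the Gaussian integral, Hoeffding's lemma at `2 θ` bounds the Bernoulli average by
`exp((2θ)²/8) = exp(θ²/2)`, which the compensator `-θ²/2` cancels exactly. This is why the noise is
doubled. -/
lemma mixtureStep_bernoulli_le {a p : ℝ} (ha : 0 ≤ a) (hp0 : 0 ≤ p) (hp1 : p ≤ 1) (b : ℝ) :
    p * mixtureStep a b (2 * (1 - p)) + (1 - p) * mixtureStep a b (2 * (0 - p)) ≤ 1 := by
  have hA : 0 < (1 + a) / 2 := by positivity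
  have hpi : 0 < Real.sqrt (2 * Real.pi) := by positivity
  refine le_of_mul_le_mul_left ?_ hpi
  have h2 : Real.sqrt (2 * Real.pi) * 1 =
      ∫ g : ℝ, Real.exp (-(1 / 2) * g ^ 2 + 0 * g + 0) := by
    rw [integral_exp_quadratic (by norm_num)]
    simp
    ring_nf
  rw [h2, mul_add, mul_left_comm, mul_left_comm (Real.sqrt _) (1 - p),
    ← integral_eq_mixtureStep ha, ← integral_eq_mixtureStep ha, ← integral_const_mul,
    ← integral_const_mul, ← integral_add]
  · refine integral_mono ?_ (integrable_exp_quadratic (by norm_num) _ _) fun g => ?_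
    · exact ((integrable_exp_quadratic hA _ _).const_mul _).add
        ((integrable_exp_quadratic hA _ _).const_mul _)
    · have h := bernoulli_exp_le hp0 hp1 (2 * (b + Real.sqrt a * g))
      have hs := Real.sq_sqrt ha
      have e1 (e : ℝ) : Real.exp (-((1 + a) / 2) * g ^ 2 + (Real.sqrt a * (2 * e - b)) * g
          + (b * (2 * e) - b ^ 2 / 2)) = Real.exp (2 * (b + Real.sqrt a * g) * e) *
            Real.exp (-((b + Real.sqrt a * g) ^ 2 + g ^ 2) / 2) := by
        rw [← Real.exp_add]
        congr 1
        linear_combination (-(g ^ 2) / 2 : ℝ) * hs * (-1)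
      simp only [e1]
      calc _ = (p * Real.exp (2 * (b + Real.sqrt a * g) * (1 - p)) +
              (1 - p) * Real.exp (2 * (b + Real.sqrt a * g) * (0 - p))) *
                Real.exp (-((b + Real.sqrt a * g) ^ 2 + g ^ 2) / 2) := by ring
        _ ≤ Real.exp ((2 * (b + Real.sqrt a * g)) ^ 2 / 8) *
              Real.exp (-((b + Real.sqrt a * g) ^ 2 + g ^ 2) / 2) := by gcongr
        _ = _ := by
          rw [← Real.exp_add]
          congr 1
          ring
  · exact (integrable_exp_quadratic hA _ _).const_mul _
  · exact (integrable_exp_quadratic hA _ _).const_mul _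

lemma sigmoidDot_pos (a : ℝ) : 0 < sigmoidDot a :=
  mul_pos (Real.sigmoid_pos a) (sub_pos.2 (Real.sigmoid_lt_one a))

lemma continuous_sigmoidDot : Continuous sigmoidDot :=
  continuous_sigmoid.mul (continuous_const.sub continuous_sigmoid)

lemma sigmoidDot_le_lip {B a : ℝ} (ha : a ∈ Set.Icc (-B) B) : sigmoidDot a ≤ lip B :=
  le_csSup (isCompact_Icc.image continuous_sigmoidDot).bddAbove (Set.mem_image_of_mem _ ha)

lemma one_div_sigmoidDot_le_kappa {B a : ℝ} (ha : a ∈ Set.Icc (-B) B) :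
    1 / sigmoidDot a ≤ kappa B :=
  le_csSup (isCompact_Icc.image (f := fun a => 1 / sigmoidDot a)
    (continuous_const.div continuous_sigmoidDot fun a => (sigmoidDot_pos a).ne')).bddAbove
    (Set.mem_image_of_mem _ ha)

lemma kappa_pos {B : ℝ} (hB : 0 ≤ B) : 0 < kappa B :=
  (one_div_pos.2 (sigmoidDot_pos 0)).trans_le (one_div_sigmoidDot_le_kappa (by simpa using hB))

lemma lip_pos {B : ℝ} (hB : 0 ≤ B) : 0 < lip B :=
  (sigmoidDot_pos 0).trans_le (sigmoidDot_le_lip (by simpa using hB))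

lemma hasDerivAt_sigmoid' (a : ℝ) : HasDerivAt Real.sigmoid (sigmoidDot a) a :=
  Real.hasDerivAt_sigmoid a

lemma abs_sigmoid_sub_le {B u v : ℝ} (hu : |u| ≤ B) (hv : |v| ≤ B) :
    |Real.sigmoid u - Real.sigmoid v| ≤ lip B * |u - v| := by
  refine (convex_Icc (-B) B).norm_image_sub_le_of_norm_hasDerivWithin_le
    (f := Real.sigmoid) (f' := sigmoidDot)
    (fun a _ => (hasDerivAt_sigmoid' a).hasDerivWithinAt) (fun a ha => ?_)
    (abs_le.1 hv) (abs_le.1 hu)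
  rw [Real.norm_of_nonneg (sigmoidDot_pos a).le]
  exact sigmoidDot_le_lip ha

/-- Strong monotonicity of the sigmoid: its slope on `[-B, B]` is at least `1/κ`. The product form
is symmetric in `u` and `v`. -/
lemma sq_sub_le_kappa_mul {B u v : ℝ} (hu : |u| ≤ B) (hv : |v| ≤ B) :
    (u - v) ^ 2 ≤ kappa B * ((Real.sigmoid u - Real.sigmoid v) * (u - v)) := by
  have hB : 0 ≤ B := (abs_nonneg u).trans hu
  have hκ := kappa_pos hB
  have main : ∀ {u v : ℝ}, |u| ≤ B → |v| ≤ B → v ≤ u →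
      u - v ≤ kappa B * (Real.sigmoid u - Real.sigmoid v) := by
    intro u v hu hv huv
    have h := (convex_Icc (-B) B).mul_sub_le_image_sub_of_le_deriv (f := Real.sigmoid)
      (C := (kappa B)⁻¹) continuous_sigmoid.continuousOn
      differentiable_sigmoid.differentiableOn
      (fun a ha => by
        rw [(hasDerivAt_sigmoid' a).deriv]
        have := one_div_sigmoidDot_le_kappa (interior_subset ha)
        rw [one_div] at this
        exact inv_le_of_inv_le₀ (sigmoidDot_pos a) this)
      v (abs_le.1 hv) u (abs_le.1 hu) huv
    rwa [inv_mul_le_iff₀ hκ] at h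
  rcases le_total v u with h | h
  · have := mul_le_mul_of_nonneg_right (main hu hv h) (sub_nonneg.2 h)
    nlinarith
  · have := mul_le_mul_of_nonneg_right (main hv hu h) (sub_nonneg.2 h)
    nlinarith

section Operators

variable {α : Type*} {H : Type*} [NormedAddCommGroup H] [InnerProductSpace ℝ H]
  [CompleteSpace H] [RKHS ℝ H α ℝ]

/-! ### Feature vectors and the regularized covariance operator -/

lemma inner_feature (z : α) (h : H) : inner ℝ (feature H z) h = h z := by
  simp [feature]

lemma kern_eq_inner (z w : α) : kern H z w = inner ℝ (feature H z) (feature H w) := by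
  rw [inner_feature, feature, RKHS.kerFun_apply, kern]

lemma feature_apply (z w : α) : feature H w z = kern H z w := by
  rw [kern_eq_inner, inner_feature]

lemma kern_comm (z w : α) : kern H z w = kern H w z := by
  rw [kern_eq_inner, kern_eq_inner, real_inner_comm]

lemma norm_feature_le {z : α} (hk : kern H z z ≤ 1) : ‖feature H z‖ ≤ 1 := by
  rw [kern_eq_inner, real_inner_self_eq_norm_sq] at hk
  nlinarith [norm_nonneg (feature H z)]

lemma abs_apply_le {z : α} (hk : kern H z z ≤ 1) (h : H) : |h z| ≤ ‖h‖ := by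
  rw [← inner_feature]
  exact (abs_real_inner_le_norm _ _).trans
    (mul_le_of_le_one_left (norm_nonneg h) (norm_feature_le hk))

lemma abs_kern_le (hk : ∀ z, kern H z z ≤ 1) (z w : α) : |kern H z w| ≤ 1 := by
  rw [← feature_apply]
  exact (abs_apply_le (hk z) _).trans (norm_feature_le (hk w))

variable (B lam : ℝ) {t : ℕ} (x : Fin t → α)

lemma covOp_apply (v : H) :
    covOp H B lam x v = (∑ i, v (x i) • feature H (x i)) + (lam * kappa B) • v := by
  simp [covOp, inner_feature]

lemma inner_covOp (u v : H) :
    inner ℝ u (covOp H B lam x v) = (∑ i, u (x i) * v (x i)) + lam * kappa B * inner ℝ u v := by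
  rw [covOp_apply, inner_add_right, inner_sum, inner_smul_right]
  congr 1
  refine Finset.sum_congr rfl fun i _ => ?_
  rw [inner_smul_right, real_inner_comm, inner_feature, mul_comm]

lemma inner_covOp_comm (u v : H) :
    inner ℝ u (covOp H B lam x v) = inner ℝ v (covOp H B lam x u) := by
  rw [inner_covOp, inner_covOp, real_inner_comm]
  simp_rw [mul_comm]

lemma inner_covOp_self (v : H) :
    inner ℝ v (covOp H B lam x v) = (∑ i, v (x i) ^ 2) + lam * kappa B * ‖v‖ ^ 2 := by
  rw [inner_covOp, real_inner_self_eq_norm_sq]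
  simp_rw [sq]

variable {B lam}

lemma inner_covOp_self_nonneg (hc : 0 < lam * kappa B) (v : H) :
    0 ≤ inner ℝ v (covOp H B lam x v) := by
  rw [inner_covOp_self]
  positivity

/-- Lax–Milgram, with coercivity constant `λκ`. Invertibility matters because
`ContinuousLinearMap.inverse` is zero at a non-invertible operator. -/
lemma exists_equiv_covOp (hc : 0 < lam * kappa B) :
    ∃ e : H ≃L[ℝ] H, (e : H →L[ℝ] H) = covOp H B lam x := by
  have hco : IsCoercive ((innerSL ℝ).comp (covOp H B lam x)) := by
    refine ⟨lam * kappa B, hc, fun u => ?_⟩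
    rw [ContinuousLinearMap.comp_apply, innerSL_apply_apply, real_inner_comm, inner_covOp_self,
      mul_assoc, ← sq]
    exact le_add_of_nonneg_left (Finset.sum_nonneg fun i _ => sq_nonneg _)
  refine ⟨hco.continuousLinearEquivOfBilin, ?_⟩
  ext1 v
  exact (hco.unique_continuousLinearEquivOfBilin (v := v) fun w => rfl).symm

lemma covOp_inverse_apply (hc : 0 < lam * kappa B) (v : H) :
    covOp H B lam x ((covOp H B lam x).inverse v) = v := by
  obtain ⟨e, he⟩ := exists_equiv_covOp (H := H) x hc
  rw [← he, ContinuousLinearMap.inverse_equiv]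
  exact e.apply_symm_apply v

lemma inverse_covOp_apply (hc : 0 < lam * kappa B) (v : H) :
    (covOp H B lam x).inverse (covOp H B lam x v) = v := by
  obtain ⟨e, he⟩ := exists_equiv_covOp (H := H) x hc
  rw [← he, ContinuousLinearMap.inverse_equiv]
  exact e.symm_apply_apply v

lemma inverse_covOp_eq (hc : 0 < lam * kappa B) {u v : H} (h : covOp H B lam x u = v) :
    (covOp H B lam x).inverse v = u := by
  rw [← h, inverse_covOp_apply x hc]

lemma inner_inverse_comm (hc : 0 < lam * kappa B) (u v : H) :
    inner ℝ u ((covOp H B lam x).inverse v) = inner ℝ v ((covOp H B lam x).inverse u) := by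
  have h := inner_covOp_comm B lam x ((covOp H B lam x).inverse u) ((covOp H B lam x).inverse v)
  rw [covOp_inverse_apply x hc, covOp_inverse_apply x hc] at h
  rw [real_inner_comm, ← h, real_inner_comm]

/-! ### The norms `‖·‖_V` and `‖·‖_{V⁻¹}` -/

lemma normV_nonneg (v : H) : 0 ≤ normV B lam x v := Real.sqrt_nonneg _

lemma normV_sq (hc : 0 < lam * kappa B) (v : H) :
    normV B lam x v ^ 2 = inner ℝ v (covOp H B lam x v) :=
  Real.sq_sqrt (inner_covOp_self_nonneg x hc v)

lemma normVinv_eq_normV (hc : 0 < lam * kappa B) (v : H) :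
    normVinv B lam x v = normV B lam x ((covOp H B lam x).inverse v) := by
  rw [normVinv, normV, covOp_inverse_apply x hc, real_inner_comm]

lemma normVinv_nonneg (v : H) : 0 ≤ normVinv B lam x v := Real.sqrt_nonneg _

lemma inner_inverse_self_nonneg (hc : 0 < lam * kappa B) (v : H) :
    0 ≤ inner ℝ v ((covOp H B lam x).inverse v) := by
  have := inner_covOp_self_nonneg x hc ((covOp H B lam x).inverse v)
  rwa [covOp_inverse_apply x hc, real_inner_comm] at this

lemma normVinv_sq (hc : 0 < lam * kappa B) (v : H) :
    normVinv B lam x v ^ 2 = inner ℝ v ((covOp H B lam x).inverse v) :=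
  Real.sq_sqrt (inner_inverse_self_nonneg x hc v)

/-- Cauchy–Schwarz for the form of `V`, from the discriminant of the nonnegative quadratic `r ↦ ‖u +
r v‖_V²`. -/
lemma inner_covOp_le (hc : 0 < lam * kappa B) (u v : H) :
    inner ℝ u (covOp H B lam x v) ≤ normV B lam x u * normV B lam x v := by
  have h := discrim_le_zero (a := inner ℝ v (covOp H B lam x v))
    (b := 2 * inner ℝ u (covOp H B lam x v)) (c := inner ℝ u (covOp H B lam x u)) fun r => by
      have h := inner_covOp_self_nonneg x hc (u + r • v)
      rw [map_add, map_smul, inner_add_left, inner_add_right, inner_add_right, inner_smul_left,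
        inner_smul_left, inner_smul_right, inner_smul_right, inner_covOp_comm B lam x v u] at h
      simp only [conj_trivial] at h
      linarith
  rw [discrim, ← normV_sq x hc, ← normV_sq x hc] at h
  refine le_of_sq_le_sq ?_ (mul_nonneg (normV_nonneg x u) (normV_nonneg x v))
  nlinarith

lemma normV_add_le (hc : 0 < lam * kappa B) (u v : H) :
    normV B lam x (u + v) ≤ normV B lam x u + normV B lam x v := by
  refine le_of_sq_le_sq ?_ (add_nonneg (normV_nonneg x u) (normV_nonneg x v))
  have h := inner_covOp_le x hc u v
  rw [normV_sq x hc, map_add, inner_add_left, inner_add_right, inner_add_right,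
    inner_covOp_comm B lam x v u, add_sq, normV_sq x hc, normV_sq x hc]
  linarith

lemma normV_neg (v : H) : normV B lam x (-v) = normV B lam x v := by
  simp [normV]

lemma normVinv_neg (v : H) : normVinv B lam x (-v) = normVinv B lam x v := by
  simp [normVinv]

lemma normV_sub_comm (u v : H) : normV B lam x (u - v) = normV B lam x (v - u) := by
  rw [← normV_neg, neg_sub]

lemma normVinv_sub_comm (u v : H) : normVinv B lam x (u - v) = normVinv B lam x (v - u) := by
  rw [← normVinv_neg, neg_sub]

lemma normVinv_add_le (hc : 0 < lam * kappa B) (u v : H) :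
    normVinv B lam x (u + v) ≤ normVinv B lam x u + normVinv B lam x v := by
  simp_rw [normVinv_eq_normV x hc, map_add]
  exact normV_add_le x hc _ _

lemma inner_le_normV_mul_normVinv (hc : 0 < lam * kappa B) (u v : H) :
    inner ℝ u v ≤ normV B lam x u * normVinv B lam x v := by
  have h := inner_covOp_le x hc u ((covOp H B lam x).inverse v)
  rwa [covOp_inverse_apply x hc, ← normVinv_eq_normV x hc] at h

/-- Since `V ≥ λκ`, the vector `w = V⁻¹ v` satisfies `λκ ‖w‖² ≤ ‖v‖_{V⁻¹}² ≤ ‖v‖ ‖w‖`. -/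
lemma normVinv_le (hc : 0 < lam * kappa B) (v : H) :
    normVinv B lam x v ≤ ‖v‖ / Real.sqrt (lam * kappa B) := by
  have hs := Real.sqrt_pos.2 hc
  set w := (covOp H B lam x).inverse v with hw
  have h1 : lam * kappa B * ‖w‖ ^ 2 ≤ normVinv B lam x v ^ 2 := by
    rw [normVinv_eq_normV x hc, normV_sq x hc, ← hw, inner_covOp_self]
    exact le_add_of_nonneg_left (Finset.sum_nonneg fun i _ => sq_nonneg _)
  have h2 : normVinv B lam x v ^ 2 ≤ ‖v‖ * ‖w‖ := by
    rw [normVinv_sq x hc]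
    exact real_inner_le_norm _ _
  have h3 : Real.sqrt (lam * kappa B) * ‖w‖ ≤ normVinv B lam x v := by
    refine le_of_sq_le_sq ?_ (normVinv_nonneg x v)
    rwa [mul_pow, Real.sq_sqrt hc.le]
  rw [le_div_iff₀ hs]
  rcases (normVinv_nonneg (B := B) (lam := lam) x v).eq_or_lt with h0 | h0
  · rw [← h0, zero_mul]
    exact norm_nonneg v
  · refine le_of_mul_le_mul_right ?_ h0
    nlinarith [mul_le_mul_of_nonneg_left h3 (norm_nonneg v),
      mul_le_mul_of_nonneg_left h2 hs.le]

/-! ### Predictive variance and mean -/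

variable (B lam) in
/-- The posterior covariance `⟨φ(z), V⁻¹ φ(w)⟩`. -/
noncomputable def postCov (z w : α) : ℝ :=
  inner ℝ (feature H z) ((covOp H B lam x).inverse (feature H w))

lemma postCov_self_nonneg (hc : 0 < lam * kappa B) (z : α) :
    0 ≤ postCov (H := H) B lam x z z := inner_inverse_self_nonneg x hc _

lemma normVinv_feature (z : α) :
    normVinv B lam x (feature H z) = Real.sqrt (postCov (H := H) B lam x z z) := rfl

lemma gram_posSemidef : (gram H x).PosSemidef := by
  refine Matrix.PosSemidef.of_dotProduct_mulVec_nonneg ?_ fun w => ?_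
  · ext i j
    simp [gram, kern_comm (H := H) (x j)]
  · have : star w ⬝ᵥ (gram H x).mulVec w = ‖∑ i, w i • feature H (x i)‖ ^ 2 := by
      rw [← real_inner_self_eq_norm_sq, sum_inner]
      simp only [dotProduct, Matrix.mulVec, star_trivial, inner_sum, inner_smul_left,
        inner_smul_right, gram, Matrix.of_apply, kern_eq_inner, conj_trivial, Finset.mul_sum]
      refine Finset.sum_congr rfl fun i _ => Finset.sum_congr rfl fun j _ => by ring
    rw [this]
    positivity

lemma gram_add_posDef {c : ℝ} (hc : 0 < c) :
    (gram H x + c • (1 : Matrix (Fin t) (Fin t) ℝ)).PosDef :=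
  Matrix.PosDef.posSemidef_add (gram_posSemidef x) (Matrix.PosDef.one.smul hc)

lemma one_add_gram_posDef {c : ℝ} (hc : 0 < c) :
    ((1 : Matrix (Fin t) (Fin t) ℝ) + c • gram H x).PosDef :=
  Matrix.PosDef.add_posSemidef Matrix.PosDef.one ((gram_posSemidef x).smul hc.le)

/-- With `w = (K + c)⁻¹ k(z)`, the vector `u = c⁻¹ (φ(z) - ∑ w_i φ(x_i))` takes the value `w_i` at
`x_i`, hence solves `V u = φ(z)`. -/
lemma mul_postCov_self (hc : 0 < lam * kappa B) (z : α) :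
    lam * kappa B * postCov (H := H) B lam x z z = kern H z z - kernVec H x z ⬝ᵥ
      (gram H x + (lam * kappa B) • (1 : Matrix (Fin t) (Fin t) ℝ))⁻¹.mulVec (kernVec H x z) := by
  set c := lam * kappa B with hcdef
  set w := (gram H x + c • (1 : Matrix (Fin t) (Fin t) ℝ))⁻¹.mulVec (kernVec H x z) with hw
  have hdet : IsUnit (gram H x + c • (1 : Matrix (Fin t) (Fin t) ℝ)).det :=
    (gram_add_posDef x hc).det_pos.ne'.isUnit
  have hww : (gram H x).mulVec w + c • w = kernVec H x z := by
    have : (gram H x + c • (1 : Matrix (Fin t) (Fin t) ℝ)).mulVec w = kernVec H x z := by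
      rw [hw, Matrix.mulVec_mulVec, Matrix.mul_nonsing_inv _ hdet, Matrix.one_mulVec]
    rwa [Matrix.add_mulVec, Matrix.smul_mulVec, Matrix.one_mulVec] at this
  set u : H := c⁻¹ • (feature H z - ∑ i, w i • feature H (x i)) with hu
  have hueval (i : Fin t) : u (x i) = w i := by
    have hi := congrFun hww i
    simp only [Pi.add_apply, Pi.smul_apply, smul_eq_mul, Matrix.mulVec, dotProduct, gram,
      Matrix.of_apply, kernVec] at hi
    rw [← inner_feature, hu, inner_smul_right, inner_sub_right, inner_sum, ← kern_eq_inner, ← hi]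
    simp_rw [inner_smul_right, ← kern_eq_inner, mul_comm (w _)]
    field_simp
    ring
  have hVu : covOp H B lam x u = feature H z := by
    rw [covOp_apply]
    simp_rw [hueval]
    rw [← hcdef, hu, smul_smul, mul_inv_cancel₀ hc.ne', one_smul]
    abel
  rw [postCov, inverse_covOp_eq x hc hVu, hu, inner_smul_right, ← mul_assoc,
    mul_inv_cancel₀ hc.ne', one_mul, inner_sub_right, ← kern_eq_inner, inner_sum]
  congr 1
  refine Finset.sum_congr rfl fun i _ => ?_
  rw [inner_smul_right, ← kern_eq_inner, kernVec, kern_comm, mul_comm]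

lemma postStd_eq (hc : 0 < lam * kappa B) (z : α) :
    postStd H B lam x z = Real.sqrt (lam * kappa B) * normVinv B lam x (feature H z) := by
  rw [postStd, ← mul_postCov_self x hc, Real.sqrt_mul hc.le, normVinv_feature]

/-! ### Adding one observation -/

section Succ

variable (x : Fin (t + 1) → α)

lemma covOp_succ_apply (v : H) :
    covOp H B lam x v = covOp H B lam (fun i : Fin t => x i.castSucc) v +
      v (x (Fin.last t)) • feature H (x (Fin.last t)) := by
  rw [covOp_apply, covOp_apply, Fin.sum_univ_castSucc]
  abel

/-- Sherman–Morrison for the rank-one update of `V` by the last point. -/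
lemma inverse_covOp_succ_apply (hc : 0 < lam * kappa B) (v : H) :
    (covOp H B lam x).inverse v = (covOp H B lam (fun i : Fin t => x i.castSucc)).inverse v -
      (inner ℝ (feature H (x (Fin.last t)))
          ((covOp H B lam (fun i : Fin t => x i.castSucc)).inverse v) /
        (1 + postCov (H := H) B lam (fun i : Fin t => x i.castSucc) (x (Fin.last t))
          (x (Fin.last t)))) •
        (covOp H B lam (fun i : Fin t => x i.castSucc)).inverse (feature H (x (Fin.last t))) := by
  refine inverse_covOp_eq x hc ?_
  have ha := postCov_self_nonneg (H := H) (fun i : Fin t => x i.castSucc) hc (x (Fin.last t))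
  rw [covOp_succ_apply, map_sub, map_smul, covOp_inverse_apply _ hc, covOp_inverse_apply _ hc,
    ← inner_feature, inner_sub_right, inner_smul_right, ← postCov, sub_add, ← sub_smul]
  rw [show ∀ a b : ℝ, a / (1 + b) - (a - a / (1 + b) * b) = a / (1 + b) * (1 + b) - a by
    intros; ring]
  rw [div_mul_cancel₀ _ (by positivity), sub_self, zero_smul, sub_zero]

/-- The last factor is the Schur complement of the leading block, identified by `mul_postCov_self`.
-/
lemma det_one_add_gram_succ (hc : 0 < lam * kappa B) :
    (1 + (lam * kappa B)⁻¹ • gram H x).det =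
      (1 + (lam * kappa B)⁻¹ • gram H (fun i : Fin t => x i.castSucc)).det *
        (1 + postCov (H := H) B lam (fun i : Fin t => x i.castSucc) (x (Fin.last t))
          (x (Fin.last t))) := by
  set c := lam * kappa B with hcdef
  set x' : Fin t → α := fun i => x i.castSucc
  set z := x (Fin.last t)
  set A : Matrix (Fin t) (Fin t) ℝ := 1 + c⁻¹ • gram H x' with hA
  have hAc : gram H x' + c • (1 : Matrix (Fin t) (Fin t) ℝ) = c • A := by
    rw [hA, smul_add, smul_smul, mul_inv_cancel₀ hc.ne', one_smul, add_comm]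
  have hAdet : IsUnit A.det := (one_add_gram_posDef x' (inv_pos.2 hc)).det_pos.ne'.isUnit
  have hinv : (c • A)⁻¹ = c⁻¹ • A⁻¹ := by
    refine Matrix.inv_eq_right_inv ?_
    rw [Matrix.smul_mul, Matrix.mul_smul, smul_smul, mul_inv_cancel₀ hc.ne', one_smul,
      Matrix.mul_nonsing_inv _ hAdet]
  have hpost := mul_postCov_self (H := H) x' hc z
  rw [← hcdef, hAc, hinv, Matrix.smul_mulVec, dotProduct_smul, smul_eq_mul] at hpost
  have hblock : (1 + c⁻¹ • gram H x).submatrix finSumFinEquiv finSumFinEquiv =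
      Matrix.fromBlocks A (Matrix.of fun i (_ : Fin 1) => c⁻¹ * kern H (x' i) z)
        (Matrix.of fun (_ : Fin 1) i => c⁻¹ * kern H (x' i) z)
        (Matrix.of fun (_ _ : Fin 1) => 1 + c⁻¹ * kern H z z) := by
    ext i j
    have h1 (i : Fin t) : finSumFinEquiv (Sum.inl i : Fin t ⊕ Fin 1) = i.castSucc := rfl
    have h2 (i : Fin 1) : finSumFinEquiv (Sum.inr i : Fin t ⊕ Fin 1) = Fin.last t := by
      ext
      simp
    rcases i with i | i <;> rcases j with j | j <;>
      simp only [Matrix.submatrix_apply, h1, h2, Matrix.add_apply, Matrix.smul_apply, gram,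
        Matrix.of_apply, Matrix.fromBlocks_apply₁₁, Matrix.fromBlocks_apply₁₂,
        Matrix.fromBlocks_apply₂₁, Matrix.fromBlocks_apply₂₂, smul_eq_mul, hA, Matrix.one_apply]
    · simp [x']
    · rw [if_neg (Fin.castSucc_lt_last i).ne, zero_add]
    · rw [if_neg (Fin.castSucc_lt_last j).ne', zero_add, kern_comm]
    · simp [z]
  have : Invertible A := Matrix.invertibleOfIsUnitDet A hAdet
  rw [← Matrix.det_submatrix_equiv_self finSumFinEquiv, hblock, Matrix.det_fromBlocks₁₁,
    Matrix.invOf_eq_nonsing_inv]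
  congr 1
  have hz : postCov (H := H) B lam x' z z =
      c⁻¹ * (kern H z z - c⁻¹ * kernVec H x' z ⬝ᵥ A⁻¹.mulVec (kernVec H x' z)) := by
    rw [← hpost]
    field_simp
  rw [Matrix.det_unique, hz]
  simp only [Matrix.sub_apply, Matrix.of_apply, Matrix.mul_apply, dotProduct, Matrix.mulVec,
    kernVec, Finset.sum_mul, Finset.mul_sum]
  rw [Finset.sum_comm, add_sub_assoc, mul_sub, Finset.mul_sum]
  congr 2
  refine Finset.sum_congr rfl fun i _ => ?_
  rw [Finset.mul_sum]
  refine Finset.sum_congr rfl fun j _ => by ring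

end Succ

end Operators

/-! ### Minimizers of strongly midpoint convex functions -/

/-- The value at a midpoint is at least the infimum, so the gap bounds the squared distance of two
near-minimizers by their excess. Hence a minimizing sequence is Cauchy and two minimizers coincide.
-/
lemma existsUnique_minimizer {E : Type*} [NormedAddCommGroup E] [NormedSpace ℝ E] [CompleteSpace E]
    {F : E → ℝ} (hF : Continuous F) (hF0 : ∀ h, 0 ≤ F h) {c : ℝ} (hc : 0 < c)
    (hmid : ∀ h h', F ((1 / 2 : ℝ) • (h + h')) + c * ‖h - h'‖ ^ 2 ≤ (F h + F h') / 2) :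
    ∃! h, ∀ h', F h ≤ F h' := by
  have hbdd : BddBelow (Set.range F) := ⟨0, by rintro _ ⟨h, rfl⟩; exact hF0 h⟩
  set m := ⨅ h, F h with hm
  have hmle (h : E) : m ≤ F h := ciInf_le hbdd h
  have hseq (n : ℕ) : ∃ h, F h < m + 1 / ((n : ℝ) + 1) :=
    exists_lt_of_ciInf_lt (lt_add_of_pos_right m Nat.one_div_pos_of_nat)
  choose u hu using hseq
  have hlim : Filter.Tendsto (fun n : ℕ => 1 / ((n : ℝ) + 1)) Filter.atTop (nhds 0) :=
    tendsto_one_div_add_atTop_nhds_zero_nat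
  have hcauchy : CauchySeq u := by
    refine cauchySeq_of_le_tendsto_0 (fun n => Real.sqrt (1 / c * (1 / ((n : ℝ) + 1)))) ?_ ?_
    · intro n k N hn hk
      rw [dist_eq_norm]
      refine Real.le_sqrt_of_sq_le ?_
      rw [one_div c, le_inv_mul_iff₀ hc]
      have h1 := hmid (u n) (u k)
      have h2 := hmle ((1 / 2 : ℝ) • (u n + u k))
      have h3 := (hu n).le.trans (add_le_add_right (Nat.one_div_le_one_div (α := ℝ) hn) m)
      have h4 := (hu k).le.trans (add_le_add_right (Nat.one_div_le_one_div (α := ℝ) hk) m)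
      linarith
    · have h := (hlim.const_mul (1 / c)).sqrt
      rwa [mul_zero, Real.sqrt_zero] at h
  obtain ⟨h, hh⟩ := cauchySeq_tendsto_of_complete hcauchy
  have hFh : F h ≤ m := by
    have h1 := (hF.tendsto h).comp hh
    have h2 := hlim.const_add m
    rw [add_zero] at h2
    exact le_of_tendsto_of_tendsto' h1 h2 fun n => (hu n).le
  refine ⟨h, fun h' => hFh.trans (hmle h'), fun h' hh' => ?_⟩
  have h1 := hmid h' h
  have h2 := hmle ((1 / 2 : ℝ) • (h' + h))
  have h3 : F h' ≤ m := (hh' h).trans hFh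
  have h4 : c * ‖h' - h‖ ^ 2 ≤ 0 := by linarith
  have h5 : ‖h' - h‖ ^ 2 = 0 := le_antisymm (by nlinarith) (sq_nonneg _)
  exact sub_eq_zero.1 (norm_eq_zero.1 (pow_eq_zero_iff two_ne_zero |>.1 h5))

/-! ### The logistic loss -/

/-- With `u = e^{-a/2}` and `v = e^{-b/2}` this is `(1 + u v)² ≤ (1 + u²)(1 + v²)`. -/
lemma neg_log_sigmoid_midpoint (a b : ℝ) :
    -Real.log (Real.sigmoid ((a + b) / 2)) ≤
      (-Real.log (Real.sigmoid a) + -Real.log (Real.sigmoid b)) / 2 := by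
  simp only [Real.sigmoid_def, Real.log_inv, neg_neg]
  set u := Real.exp (-(a / 2)) with hu
  set v := Real.exp (-(b / 2)) with hv
  have ha : Real.exp (-a) = u ^ 2 := by rw [hu, ← Real.exp_nat_mul]; congr 1; push_cast; ring
  have hb : Real.exp (-b) = v ^ 2 := by rw [hv, ← Real.exp_nat_mul]; congr 1; push_cast; ring
  have hab : Real.exp (-((a + b) / 2)) = u * v := by rw [hu, hv, ← Real.exp_add]; congr 1; ring
  have hu0 : 0 < u := Real.exp_pos _
  have hv0 : 0 < v := Real.exp_pos _
  rw [ha, hb, hab, le_div_iff₀ two_pos, mul_comm, ← Real.log_mul (by positivity) (by positivity)]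
  have : (2 : ℝ) * Real.log (1 + u * v) = Real.log ((1 + u * v) ^ 2) := by
    rw [Real.log_pow]
    norm_num
  rw [this]
  refine Real.log_le_log (by positivity) ?_
  nlinarith [sq_nonneg (u - v)]

lemma neg_log_one_sub_sigmoid_midpoint (a b : ℝ) :
    -Real.log (1 - Real.sigmoid ((a + b) / 2)) ≤
      (-Real.log (1 - Real.sigmoid a) + -Real.log (1 - Real.sigmoid b)) / 2 := by
  simp_rw [← Real.sigmoid_neg]
  have := neg_log_sigmoid_midpoint (-a) (-b)
  rwa [show (-a + -b) / 2 = -((a + b) / 2) by ring] at this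

lemma neg_log_sigmoid_nonneg (a : ℝ) : 0 ≤ -Real.log (Real.sigmoid a) :=
  neg_nonneg.2 (Real.log_nonpos (Real.sigmoid_nonneg a) (Real.sigmoid_le_one a))

lemma neg_log_one_sub_sigmoid_nonneg (a : ℝ) : 0 ≤ -Real.log (1 - Real.sigmoid a) := by
  rw [← Real.sigmoid_neg]
  exact neg_log_sigmoid_nonneg _

lemma hasDerivAt_logistic (y a : ℝ) :
    HasDerivAt (fun a => -y * Real.log (Real.sigmoid a) - (1 - y) * Real.log (1 - Real.sigmoid a))
      (Real.sigmoid a - y) a := by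
  have h1 := Real.sigmoid_pos a
  have h2 := sub_pos.2 (Real.sigmoid_lt_one a)
  have hd := hasDerivAt_sigmoid' a
  refine (((hd.log h1.ne').const_mul (-y)).sub
    (((hd.const_sub 1).log h2.ne').const_mul (1 - y))).congr_deriv ?_
  rw [sigmoidDot]
  field_simp
  ring

lemma continuous_logisticLoss {α H : Type*} [NormedAddCommGroup H] [InnerProductSpace ℝ H]
    [RKHS ℝ H α ℝ] {lam : ℝ} {t : ℕ} (x : Fin t → α) (y : Fin t → ℝ) :
    Continuous (logisticLoss (H := H) lam x y) := by
  unfold logisticLoss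
  refine (continuous_finsetSum _ fun i _ => ?_).add
    (continuous_const.mul (continuous_norm.pow 2))
  have h (a : ℝ) := (hasDerivAt_logistic (y i) a).continuousAt
  exact (continuous_iff_continuousAt.2 h).comp (RKHS.continuous_eval (x i))

section Estimator

variable {α : Type*} {H : Type*} [NormedAddCommGroup H] [InnerProductSpace ℝ H]
  [CompleteSpace H] [RKHS ℝ H α ℝ]

variable {B lam : ℝ} {t : ℕ} (x : Fin t → α) {y : Fin t → ℝ}

theorem existsUnique_isLogisticEstimator (hlam : 0 < lam) (hy : ∀ i, y i = 0 ∨ y i = 1) :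
    ∃! h : H, IsLogisticEstimator lam x y h := by
  -- The parallelogram law gains `‖h - h'‖² / 4` at the midpoint, and the penalty multiplies it by
  -- `lam / 2`.
  refine existsUnique_minimizer (c := lam / 8) (continuous_logisticLoss x y) (fun h => ?_)
    (by positivity) fun h h' => ?_
  · refine add_nonneg (Finset.sum_nonneg fun i _ => ?_) (by positivity)
    have h1 := neg_log_sigmoid_nonneg (h (x i))
    have h2 := neg_log_one_sub_sigmoid_nonneg (h (x i))
    rcases hy i with h0 | h0 <;> rw [h0] <;> linarith
  · have hnorm : ‖(1 / 2 : ℝ) • (h + h')‖ ^ 2 =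
        (‖h‖ ^ 2 + ‖h'‖ ^ 2) / 2 - ‖h - h'‖ ^ 2 / 4 := by
      rw [norm_smul, mul_pow, norm_add_sq_real, norm_sub_sq_real]
      norm_num
      ring
    have hsum : ∑ i, (-(y i) * Real.log (Real.sigmoid (((1 / 2 : ℝ) • (h + h')) (x i)))
          - (1 - y i) * Real.log (1 - Real.sigmoid (((1 / 2 : ℝ) • (h + h')) (x i)))) ≤
        ((∑ i, (-(y i) * Real.log (Real.sigmoid (h (x i)))
          - (1 - y i) * Real.log (1 - Real.sigmoid (h (x i))))) +
        ∑ i, (-(y i) * Real.log (Real.sigmoid (h' (x i)))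
          - (1 - y i) * Real.log (1 - Real.sigmoid (h' (x i))))) / 2 := by
      rw [← Finset.sum_add_distrib, Finset.sum_div]
      refine Finset.sum_le_sum fun i _ => ?_
      have he : ((1 / 2 : ℝ) • (h + h')) (x i) = (h (x i) + h' (x i)) / 2 := by
        simp
        ring
      rw [he]
      have h1 := neg_log_sigmoid_midpoint (h (x i)) (h' (x i))
      have h2 := neg_log_one_sub_sigmoid_midpoint (h (x i)) (h' (x i))
      rcases hy i with h0 | h0 <;> rw [h0] <;> linarith
    simp only [logisticLoss]
    rw [hnorm]
    linarith

/-- The derivative of the loss at `h` in the direction of its own gradient `v` is `‖v‖²`, and it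
vanishes at a minimizer. -/
lemma gradMap_eq_of_isLogisticEstimator {h : H} (hh : IsLogisticEstimator lam x y h) :
    gradMap lam x h = ∑ i, y i • feature H (x i) := by
  rw [← sub_eq_zero, ← inner_self_eq_zero (𝕜 := ℝ)]
  set v : H := gradMap lam x h - ∑ i, y i • feature H (x i) with hv
  have hd : HasDerivAt (fun s : ℝ => logisticLoss lam x y (h + s • v))
      ((∑ i, (Real.sigmoid (h (x i)) - y i) * v (x i)) + lam * inner ℝ h v) 0 := by
    unfold logisticLoss
    refine HasDerivAt.add (HasDerivAt.fun_sum fun i _ => ?_) ?_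
    · have h1 : HasDerivAt (fun s : ℝ => (h + s • v) (x i)) (v (x i)) 0 := by
        simpa using ((hasDerivAt_id (0 : ℝ)).mul_const (v (x i))).const_add (h (x i))
      have h2 := hasDerivAt_logistic (y i) ((h + (0 : ℝ) • v) (x i))
      have h3 := h2.comp (0 : ℝ) h1
      exact h3.congr_deriv (by simp)
    · have h1 (s : ℝ) : lam / 2 * ‖h + s • v‖ ^ 2 =
          lam / 2 * (‖h‖ ^ 2 + 2 * inner ℝ h v * s + ‖v‖ ^ 2 * s ^ 2) := by
        rw [norm_add_sq_real, inner_smul_right, norm_smul, mul_pow, Real.norm_eq_abs, sq_abs]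
        ring
      simp_rw [h1]
      have h2 := ((((hasDerivAt_id (0 : ℝ)).const_mul (2 * inner ℝ h v)).const_add (‖h‖ ^ 2)).add
        (((hasDerivAt_id (0 : ℝ)).pow 2).const_mul (‖v‖ ^ 2))).const_mul (lam / 2)
      refine h2.congr_deriv ?_
      simp
      ring
  have hmin : IsLocalMin (fun s : ℝ => logisticLoss lam x y (h + s • v)) 0 :=
    Filter.Eventually.of_forall fun s => by simpa using hh (h + s • v)
  have h0 := hmin.hasDerivAt_eq_zero hd
  rw [← h0]
  nth_rw 1 [hv]
  rw [gradMap, inner_sub_left, inner_add_left, sum_inner, sum_inner, inner_smul_left]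
  simp only [inner_smul_left, inner_feature, conj_trivial, sub_mul, Finset.sum_sub_distrib]
  ring

/-! ### Existence of the projected estimator -/

lemma continuous_normVinv : Continuous (normVinv (H := H) B lam x) :=
  (continuous_id.inner (ContinuousLinearMap.continuous _)).sqrt

lemma continuous_gradMap : Continuous (gradMap (H := H) lam x) := by
  unfold gradMap
  refine (continuous_finsetSum _ fun i _ => ?_).add (continuous_id.const_smul lam)
  exact (continuous_sigmoid.comp (RKHS.continuous_eval (x i))).smul continuous_const

/-- Balls of `H` need not be compact, so the problem is reduced to the span `U` of the features.
Projecting `q` onto `U` keeps its values at the data and removes only `λ (q - r)` from the gradient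
difference. This part is orthogonal to `U`, where `V` acts as `λκ`, so the cross term vanishes and
the objective does not increase. -/
theorem exists_isProjectedEstimator (hB : 0 ≤ B) (hlam : 0 < lam) {h : H}
    (hh : IsLogisticEstimator lam x y h) : ∃ p : H, IsProjectedEstimator B lam x h p := by
  have hc : 0 < lam * kappa B := mul_pos hlam (kappa_pos hB)
  set U : Submodule ℝ H := Submodule.span ℝ (Set.range fun i => feature H (x i)) with hU
  have hfin : FiniteDimensional ℝ U := FiniteDimensional.span_of_finite ℝ (Set.finite_range _)
  have hmem (i : Fin t) : feature H (x i) ∈ U := Submodule.subset_span ⟨i, rfl⟩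
  have hgradh : gradMap lam x h ∈ U := by
    rw [gradMap_eq_of_isLogisticEstimator x hh]
    exact Submodule.sum_mem _ fun i _ => Submodule.smul_mem _ _ (hmem i)
  have hgrad (q : H) (hq : q ∈ U) : gradMap lam x q ∈ U :=
    Submodule.add_mem _ (Submodule.sum_mem _ fun i _ => Submodule.smul_mem _ _ (hmem i))
      (Submodule.smul_mem _ _ hq)
  obtain ⟨p, hp, hpmin⟩ := (isCompact_closedBall (0 : U) B).exists_isMinOn
    ⟨0, by simpa using hB⟩ (f := fun q : U => normVinv B lam x (gradMap lam x (q : H) -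
      gradMap lam x h)) (((continuous_normVinv x).comp (((continuous_gradMap x).comp
      continuous_subtype_val).sub continuous_const)).continuousOn)
  refine ⟨p, by simpa using hp, fun q hq => ?_⟩
  set r : U := U.orthogonalProjectionOnto q
  have hr : r ∈ Metric.closedBall (0 : U) B := by
    rw [mem_closedBall_zero_iff]
    exact (U.norm_orthogonalProjectionOnto_apply_le q).trans hq
  refine (hpmin hr).trans ?_
  change normVinv B lam x (gradMap lam x (r : H) - gradMap lam x h) ≤ _
  have hw : q - (r : H) ∈ Uᗮ := U.sub_starProjection_mem_orthogonal q
  have hw0 (i : Fin t) : (q - (r : H)) (x i) = 0 := by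
    rw [← inner_feature]
    exact hw _ (hmem i)
  have hqr (i : Fin t) : q (x i) = (r : H) (x i) := by
    have := hw0 i
    rwa [RKHS.coe_sub, Pi.sub_apply, sub_eq_zero] at this
  set u : H := gradMap lam x (r : H) - gradMap lam x h with hu
  have hsplit : gradMap lam x q - gradMap lam x h = u + lam • (q - (r : H)) := by
    rw [hu]
    simp only [gradMap, hqr, smul_sub]
    abel
  have hinv : (covOp H B lam x).inverse (q - (r : H)) = (lam * kappa B)⁻¹ • (q - (r : H)) := by
    refine inverse_covOp_eq x hc ?_
    rw [covOp_apply, smul_smul, mul_inv_cancel₀ hc.ne', one_smul]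
    simp [hw0, -RKHS.coe_sub]
  have huw : inner ℝ u (q - (r : H)) = 0 := hw u (Submodule.sub_mem _ (hgrad _ r.2) hgradh)
  rw [hsplit, normVinv, normVinv]
  refine Real.sqrt_le_sqrt ?_
  rw [map_add, map_smul, inner_add_left, inner_add_right, inner_add_right,
    inner_inverse_comm x hc (lam • (q - (r : H))) u, map_smul, hinv]
  simp only [inner_smul_left, inner_smul_right, huw, conj_trivial, real_inner_self_eq_norm_sq]
  have : 0 ≤ lam * (lam * ((lam * kappa B)⁻¹ * ‖q - (r : H)‖ ^ 2)) := by positivity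
  linarith

/-! ### From a self-normalized bound to the confidence set -/

/-- Strong monotonicity, summed over the data, gives `‖p - q‖_V² ≤ κ ⟨p - q, g(p) - g(q)⟩`; duality
and division by `‖p - q‖_V` conclude. -/
lemma normV_sub_le_kappa_mul (hk : ∀ z, kern H z z ≤ 1) (hB : 0 ≤ B) (hlam : 0 < lam) {p q : H}
    (hp : ‖p‖ ≤ B) (hq : ‖q‖ ≤ B) :
    normV B lam x (p - q) ≤
      kappa B * normVinv B lam x (gradMap lam x p - gradMap lam x q) := by
  have hκ := kappa_pos hB
  have hc : 0 < lam * kappa B := mul_pos hlam hκ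
  have h1 : normV B lam x (p - q) ^ 2 ≤
      kappa B * inner ℝ (p - q) (gradMap lam x p - gradMap lam x q) := by
    rw [normV_sq x hc, inner_covOp_self]
    have h2 : inner ℝ (p - q) (gradMap lam x p - gradMap lam x q) =
        (∑ i, (Real.sigmoid (p (x i)) - Real.sigmoid (q (x i))) * (p (x i) - q (x i))) +
          lam * ‖p - q‖ ^ 2 := by
      have : gradMap lam x p - gradMap lam x q =
          (∑ i, (Real.sigmoid (p (x i)) - Real.sigmoid (q (x i))) • feature H (x i)) +
            lam • (p - q) := by
        simp only [gradMap, sub_smul, smul_sub, Finset.sum_sub_distrib]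
        abel
      rw [this, inner_add_right, inner_sum, inner_smul_right, real_inner_self_eq_norm_sq]
      congr 1
      refine Finset.sum_congr rfl fun i _ => ?_
      rw [inner_smul_right, real_inner_comm, inner_feature, RKHS.coe_sub, Pi.sub_apply]
    rw [h2, mul_add, Finset.mul_sum]
    refine add_le_add (Finset.sum_le_sum fun i _ => ?_) (by linarith)
    rw [RKHS.coe_sub, Pi.sub_apply]
    exact sq_sub_le_kappa_mul ((abs_apply_le (hk _) p).trans hp) ((abs_apply_le (hk _) q).trans hq)
  have h3 := inner_le_normV_mul_normVinv x hc (p - q) (gradMap lam x p - gradMap lam x q)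
  rcases (normV_nonneg (B := B) (lam := lam) x (p - q)).eq_or_lt with h0 | h0
  · rw [← h0]
    exact mul_nonneg hκ.le (normVinv_nonneg x _)
  · refine le_of_mul_le_mul_left ?_ h0
    nlinarith [mul_le_mul_of_nonneg_left h3 hκ.le]

lemma abs_sigmoid_sub_le_postStd (hk : ∀ z, kern H z z ≤ 1) (hB : 0 ≤ B) (hlam : 0 < lam) {p q : H}
    (hp : ‖p‖ ≤ B) (hq : ‖q‖ ≤ B) (z : α) :
    |Real.sigmoid (p z) - Real.sigmoid (q z)| ≤
      lip B / Real.sqrt (lam * kappa B) * normV B lam x (p - q) * postStd H B lam x z := by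
  have hc : 0 < lam * kappa B := mul_pos hlam (kappa_pos hB)
  have hs := Real.sqrt_pos.2 hc
  refine (abs_sigmoid_sub_le ((abs_apply_le (hk z) p).trans hp)
    ((abs_apply_le (hk z) q).trans hq)).trans ?_
  have main (p q : H) : p z - q z ≤ normV B lam x (p - q) * normVinv B lam x (feature H z) := by
    have := inner_le_normV_mul_normVinv x hc (p - q) (feature H z)
    rwa [real_inner_comm, inner_feature, RKHS.coe_sub, Pi.sub_apply] at this
  have habs : |p z - q z| ≤ normV B lam x (p - q) * normVinv B lam x (feature H z) := by
    refine abs_le.2 ⟨?_, main p q⟩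
    have := main q p
    rw [normV_sub_comm] at this
    linarith
  refine (mul_le_mul_of_nonneg_left habs (lip_pos hB).le).trans (le_of_eq ?_)
  rw [postStd_eq x hc]
  field_simp

/-! ### The information gain -/

variable (lam) in
-- A real supremum dominates its terms only if the family is bounded above; the permutation
-- expansion of the determinant with entries at most `1 + c` suffices.
lemma log_det_le_infoGain (hk : ∀ z, kern H z z ≤ 1) (hB : 0 ≤ B) (hlam : 0 < lam) :
    (1 / 2) * Real.log ((1 : Matrix (Fin t) (Fin t) ℝ) + (lam * kappa B)⁻¹ • gram H x).det ≤
      infoGain H B lam t := by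
  have hc : 0 < (lam * kappa B)⁻¹ := inv_pos.2 (mul_pos hlam (kappa_pos hB))
  set c := (lam * kappa B)⁻¹
  refine le_ciSup (f := fun x : Fin t → α =>
    (1 / 2) * Real.log ((1 : Matrix (Fin t) (Fin t) ℝ) + c • gram H x).det) ?_ x
  refine ⟨1 / 2 * Real.log ((Fintype.card (Fin t)).factorial •
    (1 + c) ^ Fintype.card (Fin t)), ?_⟩
  rintro _ ⟨x', rfl⟩
  refine mul_le_mul_of_nonneg_left ?_ (by norm_num)
  refine Real.log_le_log (one_add_gram_posDef x' hc).det_pos ?_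
  refine (le_abs_self _).trans (Matrix.det_le (abv := AbsoluteValue.abs) fun i j => ?_)
  simp only [AbsoluteValue.abs_apply, Matrix.add_apply, Matrix.smul_apply, smul_eq_mul, gram,
    Matrix.of_apply]
  refine (abs_add_le _ _).trans (add_le_add ?_ ?_)
  · rw [Matrix.one_apply]
    split_ifs <;> simp
  · rw [abs_mul, abs_of_pos hc]
    exact mul_le_of_le_one_right hc.le (abs_kern_le hk _ _)

/-- The self-normalized bound on the noise implies all error bounds at time `t`. -/
theorem confidence_bounds_of_noise_bound (hk : ∀ z, kern H z z ≤ 1) (hlam : 0 < lam) {δ : ℝ}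
    {f h : H} (hf : ‖f‖ ≤ B) (hh : IsLogisticEstimator lam x y h)
    (hnoise : 2 * normVinv B lam x
      (∑ i, (y i - Real.sigmoid (f (x i))) • feature H (x i)) ^ 2 ≤
        Real.log (1 / δ) + infoGain H B lam t)
    {p : H} (hp : IsProjectedEstimator B lam x h p) {q : H} (hq : ‖q‖ ≤ B)
    (hqp : normV B lam x (q - p) ≤ 2 * Real.sqrt (lam * kappa B) * B +
      kappa B * Real.sqrt (2 * Real.log (1 / δ) + 2 * infoGain H B lam t)) (z : α) :
    |Real.sigmoid (q z) - Real.sigmoid (f z)| ≤ betaCoef H B lam δ t * postStd H B lam x z := by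
  have hB : 0 ≤ B := (norm_nonneg f).trans hf
  have hκ := kappa_pos hB
  have hc : 0 < lam * kappa B := mul_pos hlam hκ
  have hs := Real.sqrt_pos.2 hc
  set s := Real.sqrt (lam * kappa B) with hsdef
  have hs2 : s ^ 2 = lam * kappa B := Real.sq_sqrt hc.le
  set G := Real.log (1 / δ) + infoGain H B lam t with hG
  have hroot : Real.sqrt (2 * Real.log (1 / δ) + 2 * infoGain H B lam t) = Real.sqrt (2 * G) := by
    rw [hG, mul_add]
  rw [hroot] at hqp
  set S : H := ∑ i, (y i - Real.sigmoid (f (x i))) • feature H (x i) with hS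
  have hdiff : gradMap lam x h - gradMap lam x f = S + (-(lam • f)) := by
    rw [gradMap_eq_of_isLogisticEstimator x hh, hS]
    simp only [gradMap, sub_smul, Finset.sum_sub_distrib]
    abel
  -- The factor two gained from the noise being `1/2`-subgaussian absorbs the factor two lost in the
  -- projection.
  have hSle : 2 * normVinv B lam x S ≤ Real.sqrt (2 * G) := by
    refine Real.le_sqrt_of_sq_le ?_
    linarith
  have hfle : normVinv B lam x (lam • f) ≤ lam * B / s := by
    refine (normVinv_le x hc _).trans ?_
    rw [norm_smul, Real.norm_of_nonneg hlam.le]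
    gcongr
  have hgf : 2 * normVinv B lam x (gradMap lam x h - gradMap lam x f) ≤
      Real.sqrt (2 * G) + 2 * (lam * B / s) := by
    have := normVinv_add_le x hc S (-(lam • f))
    rw [normVinv_neg] at this
    rw [hdiff]
    linarith
  have hpf : normVinv B lam x (gradMap lam x p - gradMap lam x f) ≤
      Real.sqrt (2 * G) + 2 * (lam * B / s) := by
    have h1 := normVinv_add_le x hc (gradMap lam x p - gradMap lam x h)
      (gradMap lam x h - gradMap lam x f)
    have h2 := hp.2 f hf
    rw [normVinv_sub_comm x (gradMap lam x f)] at h2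
    rw [sub_add_sub_cancel] at h1
    linarith
  have hpfV : normV B lam x (p - f) ≤ 2 * s * B + kappa B * Real.sqrt (2 * G) := by
    refine (normV_sub_le_kappa_mul x hk hB hlam hp.1 hf).trans ?_
    refine (mul_le_mul_of_nonneg_left hpf hκ.le).trans (le_of_eq ?_)
    have : kappa B * (2 * (lam * B / s)) = 2 * s * B := by
      field_simp
      rw [hs2]
      ring
    rw [mul_add, this, add_comm]
  -- The radius of the confidence set equals the bound on `‖p - f‖_V`, so the triangle inequality
  -- exactly doubles it.
  have hqf : normV B lam x (q - f) ≤ 2 * (2 * s * B + kappa B * Real.sqrt (2 * G)) := by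
    have := normV_add_le x hc (q - p) (p - f)
    rw [sub_add_sub_cancel] at this
    linarith
  refine (abs_sigmoid_sub_le_postStd x hk hB hlam hq hf z).trans ?_
  refine mul_le_mul_of_nonneg_right ?_ (Real.sqrt_nonneg _)
  refine (mul_le_mul_of_nonneg_left hqf (div_nonneg (lip_pos hB).le hs.le)).trans (le_of_eq ?_)
  have hβ : Real.sqrt (2 * kappa B / lam * (infoGain H B lam t + Real.log (1 / δ))) =
      kappa B / s * Real.sqrt (2 * G) := by
    have h1 : 2 * kappa B / lam * (infoGain H B lam t + Real.log (1 / δ)) =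
        (kappa B / s) ^ 2 * (2 * G) := by
      rw [div_pow, hs2, hG]
      field_simp
      ring
    rw [h1, Real.sqrt_mul (sq_nonneg _), Real.sqrt_sq (by positivity)]
  rw [betaCoef, hβ]
  field_simp
  ring

end Estimator

/-! ### A maximal inequality for products of conditionally contractive factors -/

section Ville

open scoped ENNReal

variable {Ω : Type*}

/-- The partial products of `R`, frozen as soon as they reach the level `c`. -/
noncomputable def stoppedProd (R : ℕ → Ω → ℝ≥0∞) (c : ℝ≥0∞) : ℕ → Ω → ℝ≥0∞
  | 0 => fun _ => 1
  | t + 1 => fun ω => {ω | c ≤ stoppedProd R c t ω}.indicator (stoppedProd R c t) ω +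
      {ω | c ≤ stoppedProd R c t ω}ᶜ.indicator (stoppedProd R c t) ω * R t ω

lemma stoppedProd_succ_of_le {R : ℕ → Ω → ℝ≥0∞} {c : ℝ≥0∞} {t : ℕ} {ω : Ω}
    (h : c ≤ stoppedProd R c t ω) : stoppedProd R c (t + 1) ω = stoppedProd R c t ω := by
  simp [stoppedProd, h]

lemma stoppedProd_succ_of_lt {R : ℕ → Ω → ℝ≥0∞} {c : ℝ≥0∞} {t : ℕ} {ω : Ω}
    (h : stoppedProd R c t ω < c) :
    stoppedProd R c (t + 1) ω = stoppedProd R c t ω * R t ω := by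
  simp [stoppedProd, h.not_ge]

lemma stoppedProd_eq_prod {R : ℕ → Ω → ℝ≥0∞} {c : ℝ≥0∞} {ω : Ω}
    (h : ∀ t, stoppedProd R c t ω < c) (t : ℕ) :
    stoppedProd R c t ω = ∏ i ∈ Finset.range t, R i ω := by
  induction t with
  | zero => simp [stoppedProd]
  | succ t ih => rw [stoppedProd_succ_of_lt (h t), ih, Finset.prod_range_succ]

lemma measurable_stoppedProd {R : ℕ → Ω → ℝ≥0∞} {ℱ : ℕ → MeasurableSpace Ω} (hmono : Monotone ℱ)
    (hR : ∀ t, Measurable[ℱ (t + 1)] (R t)) (c : ℝ≥0∞) (t : ℕ) :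
    Measurable[ℱ t] (stoppedProd R c t) := by
  induction t with
  | zero => exact measurable_const
  | succ t ih =>
    have ih' : Measurable[ℱ (t + 1)] (stoppedProd R c t) := ih.mono (hmono t.le_succ) le_rfl
    have hs : MeasurableSet[ℱ (t + 1)] {ω | c ≤ stoppedProd R c t ω} :=
      ih' measurableSet_Ici
    exact (ih'.indicator hs).add ((ih'.indicator hs.compl).mul (hR t))

/-- A form of Ville's inequality: if each factor `R t` has conditional expectation at most one given
`ℱ t`, then with probability at least `1 - 1 / c` no partial product reaches `c`. -/
theorem exists_measurableSet_prod_lt [mΩ : MeasurableSpace Ω] (μ : Measure Ω)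
    [IsProbabilityMeasure μ] {R : ℕ → Ω → ℝ≥0∞} {ℱ : ℕ → MeasurableSpace Ω} (hmono : Monotone ℱ)
    (hle : ∀ t, ℱ t ≤ mΩ) (hR : ∀ t, Measurable[ℱ (t + 1)] (R t))
    (hcontr : ∀ t (G : Ω → ℝ≥0∞), Measurable[ℱ t] G → ∫⁻ ω, G ω * R t ω ∂μ ≤ ∫⁻ ω, G ω ∂μ)
    {c : ℝ≥0∞} (hc0 : c ≠ 0) (hc : c ≠ ∞) :
    ∃ E : Set Ω, MeasurableSet E ∧ μ Eᶜ ≤ 1 / c ∧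
      ∀ ω ∈ E, ∀ t, ∏ i ∈ Finset.range t, R i ω < c := by
  have hmeas (t : ℕ) := measurable_stoppedProd hmono hR c t
  have hmeas' (t : ℕ) : Measurable (stoppedProd R c t) := (hmeas t).mono (hle t) le_rfl
  have hint (t : ℕ) : ∫⁻ ω, stoppedProd R c t ω ∂μ ≤ 1 := by
    induction t with
    | zero => simp [stoppedProd]
    | succ t ih =>
      have hs : MeasurableSet[ℱ t] {ω | c ≤ stoppedProd R c t ω} := hmeas t measurableSet_Ici
      calc ∫⁻ ω, stoppedProd R c (t + 1) ω ∂μ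
          = ∫⁻ ω, {ω | c ≤ stoppedProd R c t ω}.indicator (stoppedProd R c t) ω ∂μ +
            ∫⁻ ω, {ω | c ≤ stoppedProd R c t ω}ᶜ.indicator (stoppedProd R c t) ω * R t ω ∂μ :=
            lintegral_add_left ((hmeas' t).indicator (hle t _ hs)) _
        _ ≤ ∫⁻ ω, {ω | c ≤ stoppedProd R c t ω}.indicator (stoppedProd R c t) ω ∂μ +
            ∫⁻ ω, {ω | c ≤ stoppedProd R c t ω}ᶜ.indicator (stoppedProd R c t) ω ∂μ := by
            refine add_le_add le_rfl ?_
            exact hcontr t _ ((hmeas t).indicator hs.compl)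
        _ = ∫⁻ ω, stoppedProd R c t ω ∂μ := by
            rw [← lintegral_add_left ((hmeas' t).indicator (hle t _ hs))]
            congr 1
            ext ω
            exact congrFun (Set.indicator_self_add_compl _ _) ω
        _ ≤ 1 := ih
  -- Freezing makes the crossing events increase with `t`, so the probability of their union is a
  -- supremum of Markov bounds.
  have hmono' : Monotone fun t => {ω | c ≤ stoppedProd R c t ω} :=
    monotone_nat_of_le_succ fun t ω hω => by
      exact hω.trans_eq (stoppedProd_succ_of_le hω).symm
  refine ⟨(⋃ t, {ω | c ≤ stoppedProd R c t ω})ᶜ,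
    (MeasurableSet.iUnion fun t => hmeas' t measurableSet_Ici).compl, ?_, fun ω hω t => ?_⟩
  · rw [compl_compl, hmono'.measure_iUnion]
    refine iSup_le fun t => ?_
    exact (meas_ge_le_lintegral_div (hmeas' t).aemeasurable hc0 hc).trans (by gcongr; exact hint t)
  · have h : ∀ t, stoppedProd R c t ω < c := by simpa using hω
    rw [← stoppedProd_eq_prod h]
    exact h t

/-! ### Integrals against conditional probabilities -/

/-- The restriction of `μ` to `s` and the measure with density `q` agree on `m` by the definition of
conditional probability, so they integrate `m`-measurable functions alike, without integrability. -/
lemma setLIntegral_eq_of_condProb {m : MeasurableSpace Ω} [mΩ : MeasurableSpace Ω] {μ : Measure Ω}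
    [IsProbabilityMeasure μ] (hm : m ≤ mΩ) {s : Set Ω} (hs : MeasurableSet s) {q : Ω → ℝ}
    (hq : Measurable[m] q) (hq0 : ∀ ω, 0 ≤ q ω) (hq1 : ∀ ω, q ω ≤ 1) (hcond : μ⟦s | m⟧ =ᵐ[μ] q)
    {G : Ω → ℝ≥0∞} (hG : Measurable[m] G) :
    ∫⁻ ω in s, G ω ∂μ = ∫⁻ ω, ENNReal.ofReal (q ω) * G ω ∂μ := by
  have hqm : Measurable q := hq.mono hm le_rfl
  have hqi : Integrable q μ := Integrable.of_bound hqm.aestronglyMeasurable 1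
    (Filter.Eventually.of_forall fun ω => by
      rw [Real.norm_of_nonneg (hq0 ω)]
      exact hq1 ω)
  have htrim : (μ.restrict s).trim hm = (μ.withDensity fun ω => ENNReal.ofReal (q ω)).trim hm := by
    refine @Measure.ext _ m _ _ fun A hA => ?_
    have hA' := hm A hA
    rw [trim_measurableSet_eq hm hA, trim_measurableSet_eq hm hA, Measure.restrict_apply hA',
      withDensity_apply _ hA', ← ofReal_integral_eq_lintegral_ofReal hqi.integrableOn
        (Filter.Eventually.of_forall hq0)]
    have h1 : ∫ ω in A, q ω ∂μ = ∫ ω in A, (μ⟦s | m⟧) ω ∂μ :=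
      (setIntegral_congr_ae hA' (hcond.mono fun ω h _ => h)).symm
    rw [h1, setIntegral_condExp hm ((integrable_const (1 : ℝ)).indicator hs) hA,
      integral_indicator hs, integral_const, Measure.restrict_restrict hs, smul_eq_mul, mul_one,
      measureReal_restrict_apply_univ, ofReal_measureReal, Set.inter_comm]
  rw [← lintegral_trim hm hG, htrim, lintegral_trim hm hG,
    lintegral_withDensity_eq_lintegral_mul _ hqm.ennreal_ofReal (hG.mono hm le_rfl)]
  rfl

lemma condProb_compl {m : MeasurableSpace Ω} [mΩ : MeasurableSpace Ω] {μ : Measure Ω}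
    [IsProbabilityMeasure μ] (hm : m ≤ mΩ) {s : Set Ω} (hs : MeasurableSet s) {q : Ω → ℝ}
    (hcond : μ⟦s | m⟧ =ᵐ[μ] q) : μ⟦sᶜ | m⟧ =ᵐ[μ] fun ω => 1 - q ω := by
  have h : (sᶜ.indicator fun _ => (1 : ℝ)) = (fun _ => (1 : ℝ)) - s.indicator fun _ => (1 : ℝ) := by
    ext ω
    by_cases hω : ω ∈ s <;> simp [hω]
  rw [h]
  refine (condExp_sub (integrable_const _) ((integrable_const (1 : ℝ)).indicator hs) m).trans ?_
  rw [condExp_const hm]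
  filter_upwards [hcond] with ω hω
  simp [hω]

/-- A `{0, 1}`-valued variable with conditional success probability `q` keeps the Gaussian mixture
factor conditionally below one. -/
lemma lintegral_mul_mixtureStep_le {m : MeasurableSpace Ω} [mΩ : MeasurableSpace Ω] {μ : Measure Ω}
    [IsProbabilityMeasure μ] (hm : m ≤ mΩ) {Y : Ω → ℝ} (hY : Measurable Y)
    (hY01 : ∀ ω, Y ω = 0 ∨ Y ω = 1) {q a b : Ω → ℝ} (hq : Measurable[m] q) (hq0 : ∀ ω, 0 ≤ q ω)
    (hq1 : ∀ ω, q ω ≤ 1) (hcond : μ⟦{ω | Y ω = 1} | m⟧ =ᵐ[μ] q) (ha : Measurable[m] a)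
    (ha0 : ∀ ω, 0 ≤ a ω) (hb : Measurable[m] b) {G : Ω → ℝ≥0∞} (hG : Measurable[m] G) :
    ∫⁻ ω, G ω * ENNReal.ofReal (mixtureStep (a ω) (b ω) (2 * (Y ω - q ω))) ∂μ ≤ ∫⁻ ω, G ω ∂μ := by
  have hs : MeasurableSet {ω | Y ω = 1} := hY (measurableSet_singleton 1)
  have hF (v : ℝ) : Measurable[m] fun ω =>
      G ω * ENNReal.ofReal (mixtureStep (a ω) (b ω) (2 * (v - q ω))) := by
    refine hG.mul (Measurable.ennreal_ofReal ?_)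
    unfold mixtureStep
    fun_prop
  -- On each of the two events `Y` is constant, which leaves an `m`-measurable integrand.
  rw [← lintegral_add_compl _ hs]
  have h1 : ∫⁻ ω in {ω | Y ω = 1}, G ω * ENNReal.ofReal (mixtureStep (a ω) (b ω)
      (2 * (Y ω - q ω))) ∂μ = ∫⁻ ω in {ω | Y ω = 1}, G ω * ENNReal.ofReal (mixtureStep (a ω) (b ω)
      (2 * (1 - q ω))) ∂μ := by
    refine setLIntegral_congr_fun hs fun ω hω => ?_
    have : Y ω = 1 := hω
    simp only [this]
  have h0 : ∫⁻ ω in {ω | Y ω = 1}ᶜ, G ω * ENNReal.ofReal (mixtureStep (a ω) (b ω)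
      (2 * (Y ω - q ω))) ∂μ = ∫⁻ ω in {ω | Y ω = 1}ᶜ, G ω * ENNReal.ofReal (mixtureStep (a ω) (b ω)
      (2 * (0 - q ω))) ∂μ := by
    refine setLIntegral_congr_fun hs.compl fun ω hω => ?_
    have : Y ω = 0 := (hY01 ω).resolve_right hω
    simp only [this]
  have hq' : Measurable[m] fun ω => 1 - q ω := measurable_const.sub hq
  rw [h1, h0, setLIntegral_eq_of_condProb hm hs hq hq0 hq1 hcond (hF 1),
    setLIntegral_eq_of_condProb hm hs.compl hq' (fun ω => sub_nonneg.2 (hq1 ω))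
      (fun ω => sub_le_self 1 (hq0 ω)) (condProb_compl hm hs hcond) (hF 0)]
  have hF1 : Measurable fun ω => ENNReal.ofReal (q ω) *
      (G ω * ENNReal.ofReal (mixtureStep (a ω) (b ω) (2 * (1 - q ω)))) :=
    (hq.ennreal_ofReal.mul (hF 1)).mono hm le_rfl
  rw [← lintegral_add_left hF1]
  refine lintegral_mono fun ω => ?_
  rw [mul_left_comm, mul_left_comm (ENNReal.ofReal (1 - q ω)), ← mul_add,
    ← ENNReal.ofReal_mul (hq0 ω), ← ENNReal.ofReal_mul (sub_nonneg.2 (hq1 ω)),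
    ← ENNReal.ofReal_add (mul_nonneg (hq0 ω) (mixtureStep_pos (ha0 ω) _ _).le)
      (mul_nonneg (sub_nonneg.2 (hq1 ω)) (mixtureStep_pos (ha0 ω) _ _).le)]
  refine mul_le_of_le_one_right' ?_
  rw [ENNReal.ofReal_le_one]
  exact mixtureStep_bernoulli_le (ha0 ω) (hq0 ω) (hq1 ω) (b ω)

end Ville

/-! ### The self-normalized process -/

section SelfNormalized

variable {α : Type*} {H : Type*} [NormedAddCommGroup H] [InnerProductSpace ℝ H]
  [CompleteSpace H] [RKHS ℝ H α ℝ] {B lam : ℝ}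

lemma postCov_zero (hc : 0 < lam * kappa B) (x : Fin 0 → α) (z w : α) :
    postCov (H := H) B lam x z w = (lam * kappa B)⁻¹ * kern H z w := by
  rw [postCov, inverse_covOp_eq x hc (u := (lam * kappa B)⁻¹ • feature H w), inner_smul_right,
    kern_eq_inner]
  rw [covOp_apply, smul_smul, mul_inv_cancel₀ hc.ne']
  simp

lemma postCov_succ (hc : 0 < lam * kappa B) {t : ℕ} (x : Fin (t + 1) → α) (z w : α) :
    postCov (H := H) B lam x z w = postCov (H := H) B lam (fun i : Fin t => x i.castSucc) z w -
      postCov (H := H) B lam (fun i : Fin t => x i.castSucc) (x (Fin.last t)) w /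
        (1 + postCov (H := H) B lam (fun i : Fin t => x i.castSucc) (x (Fin.last t))
          (x (Fin.last t))) *
        postCov (H := H) B lam (fun i : Fin t => x i.castSucc) z (x (Fin.last t)) := by
  rw [postCov, inverse_covOp_succ_apply x hc, inner_sub_right, inner_smul_right]
  rfl

variable (B lam) in
/-- The predictive mean of the noise `e` at the point `z`. -/
noncomputable def postMean (H : Type*) [NormedAddCommGroup H] [InnerProductSpace ℝ H]
    [CompleteSpace H] [RKHS ℝ H α ℝ] {t : ℕ} (x : Fin t → α) (e : Fin t → ℝ) (z : α) : ℝ :=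
  ∑ i, e i * postCov (H := H) B lam x z (x i)

lemma postMean_eq_inner {t : ℕ} (x : Fin t → α) (e : Fin t → ℝ) (z : α) :
    postMean B lam H x e z =
      inner ℝ (feature H z) ((covOp H B lam x).inverse (∑ i, e i • feature H (x i))) := by
  simp [postMean, postCov, map_sum, inner_sum, inner_smul_right]

/-- By Sherman–Morrison; the increment is exactly twice the exponent of `mixtureStep`. -/
lemma normVinv_sq_succ (hc : 0 < lam * kappa B) {t : ℕ} (x : Fin (t + 1) → α)
    (e : Fin (t + 1) → ℝ) :
    normVinv B lam x (∑ i, e i • feature H (x i)) ^ 2 =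
      normVinv B lam (fun i : Fin t => x i.castSucc)
        (∑ i : Fin t, e i.castSucc • feature H (x i.castSucc)) ^ 2 +
      (postCov (H := H) B lam (fun i : Fin t => x i.castSucc) (x (Fin.last t)) (x (Fin.last t)) *
          e (Fin.last t) ^ 2 +
        2 * postMean B lam H (fun i : Fin t => x i.castSucc) (fun i => e i.castSucc)
          (x (Fin.last t)) * e (Fin.last t) -
        postMean B lam H (fun i : Fin t => x i.castSucc) (fun i => e i.castSucc)
          (x (Fin.last t)) ^ 2) /
        (1 + postCov (H := H) B lam (fun i : Fin t => x i.castSucc) (x (Fin.last t))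
          (x (Fin.last t))) := by
  have ha := postCov_self_nonneg (H := H) (fun i : Fin t => x i.castSucc) hc (x (Fin.last t))
  rw [normVinv_sq _ hc, normVinv_sq _ hc, Fin.sum_univ_castSucc, postMean_eq_inner,
    inverse_covOp_succ_apply x hc]
  set x' : Fin t → α := fun i => x i.castSucc
  set φ := feature H (x (Fin.last t))
  set S := ∑ i : Fin t, e i.castSucc • feature H (x i.castSucc)
  set a := postCov (H := H) B lam x' (x (Fin.last t)) (x (Fin.last t)) with hadef
  have h1 : inner ℝ S ((covOp H B lam x').inverse φ) = inner ℝ φ ((covOp H B lam x').inverse S) :=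
    inner_inverse_comm x' hc _ _
  have h2 : inner ℝ φ ((covOp H B lam x').inverse φ) = a := rfl
  simp only [map_add, map_smul, inner_sub_right, inner_add_left, inner_add_right, inner_smul_left,
    inner_smul_right, conj_trivial, h1, h2]
  field_simp
  ring

lemma prod_mixtureStep_eq (hc : 0 < lam * kappa B) (x : ℕ → α) (e : ℕ → ℝ) (t : ℕ) :
    ∏ s ∈ Finset.range t, mixtureStep
      (postCov (H := H) B lam (fun i : Fin s => x i) (x s) (x s))
      (postMean B lam H (fun i : Fin s => x i) (fun i => e i) (x s)) (e s) =
    Real.exp (normVinv B lam (fun i : Fin t => x i)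
        (∑ i : Fin t, e i • feature H (x i)) ^ 2 / 2) /
      Real.sqrt (1 + (lam * kappa B)⁻¹ • gram H (fun i : Fin t => x i)).det := by
  induction t with
  | zero => simp [normVinv]
  | succ t ih =>
    have ha := postCov_self_nonneg (H := H) (fun i : Fin t => x i) hc (x t)
    have hdet := (one_add_gram_posDef (H := H) (fun i : Fin t => x i) (inv_pos.2 hc)).det_pos
    rw [Finset.prod_range_succ, ih, normVinv_sq_succ hc, det_one_add_gram_succ _ hc]
    simp only [Fin.val_castSucc, Fin.val_last]
    rw [Real.sqrt_mul hdet.le, mixtureStep, div_mul_div_comm, ← Real.exp_add]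
    congr 2
    field_simp

variable [MeasurableSpace α]

/-- Every element of `H` is a pointwise limit of finite combinations of kernel sections, as these
are dense and evaluations are continuous. -/
lemma measurable_apply (hk : Measurable (Function.uncurry (kern H : α → α → ℝ))) (f : H) :
    Measurable (f : α → ℝ) := by
  have hf : f ∈ (Submodule.span ℝ {RKHS.kerFun H z v | (z : α) (v : ℝ)}).topologicalClosure := by
    rw [RKHS.kerFun_dense]
    trivial
  obtain ⟨u, hu, hlim⟩ := mem_closure_iff_seq_limit.1 hf
  refine measurable_of_tendsto_metrizable (f := fun n => (u n : α → ℝ)) (fun n => ?_)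
    (tendsto_pi_nhds.2 fun z => ((RKHS.continuous_eval (𝕜 := ℝ) z).tendsto f).comp hlim)
  have hn : u n ∈ Submodule.span ℝ {RKHS.kerFun H z v | (z : α) (v : ℝ)} := hu n
  generalize u n = g at hn
  induction hn using Submodule.span_induction with
  | mem g hg =>
    obtain ⟨z, v, rfl⟩ := hg
    have h : ((RKHS.kerFun H z v : H) : α → ℝ) = fun w => v * kern H w z := by
      ext w
      rw [← feature_apply, feature, ← smul_eq_mul, ← Pi.smul_apply, ← RKHS.coe_smul, ← map_smul,
        smul_eq_mul, mul_one]
    rw [h]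
    exact (hk.comp (measurable_id.prodMk measurable_const)).const_mul v
  | zero =>
    rw [RKHS.coe_zero]
    exact measurable_const
  | add g h _ _ hg hh => simpa using hg.add hh
  | smul a g _ hg => simpa using hg.const_smul a

/-- The recursion `postCov_succ` expresses the posterior covariance through kernel values alone, so
`H` and its operators need no measurable structure. -/
lemma measurable_postCov (hc : 0 < lam * kappa B)
    (hk : Measurable (Function.uncurry (kern H : α → α → ℝ))) {Ω : Type*} {m : MeasurableSpace Ω}
    {t : ℕ} {x : Fin t → Ω → α} (hx : ∀ i, Measurable (x i)) {u v : Ω → α} (hu : Measurable u)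
    (hv : Measurable v) :
    Measurable fun ω => postCov (H := H) B lam (fun i => x i ω) (u ω) (v ω) := by
  induction t generalizing u v with
  | zero =>
    simp_rw [postCov_zero hc]
    exact (hk.comp (hu.prodMk hv)).const_mul _
  | succ t ih =>
    simp_rw [postCov_succ hc]
    have ih' {u v : Ω → α} (hu : Measurable u) (hv : Measurable v) :=
      ih (x := fun i => x i.castSucc) (fun i => hx _) hu hv
    have hl := hx (Fin.last t)
    exact (ih' hu hv).sub (((ih' hl hv).div ((ih' hl hl).const_add 1)).mul (ih' hu hl))

section History

variable {Ω : Type*} {x : ℕ → Ω → α} {y : ℕ → Ω → ℝ}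

lemma history_mono : Monotone (history x y) := fun s t hst => by
  refine sup_le_sup ?_ ?_
  · exact biSup_mono fun i hi => hi.trans hst
  · exact biSup_mono fun i hi => hi.trans_le hst

lemma history_le [mΩ : MeasurableSpace Ω] (hx : ∀ i, Measurable (x i)) (hy : ∀ i, Measurable (y i))
    (t : ℕ) : history x y t ≤ mΩ :=
  sup_le (iSup₂_le fun i _ => (hx i).comap_le) (iSup₂_le fun i _ => (hy i).comap_le)

lemma measurable_action_history {i t : ℕ} (h : i ≤ t) : Measurable[history x y t] (x i) :=
  measurable_iff_comap_le.2 ((le_iSup₂ (f := fun i (_ : i ≤ t) =>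
    MeasurableSpace.comap (x i) inferInstance) i h).trans le_sup_left)

lemma measurable_feedback_history {i t : ℕ} (h : i < t) : Measurable[history x y t] (y i) :=
  measurable_iff_comap_le.2 ((le_iSup₂ (f := fun i (_ : i < t) =>
    MeasurableSpace.comap (y i) inferInstance) i h).trans le_sup_right)

end History

/-- The time-uniform self-normalized bound for Bernoulli noise. -/
theorem exists_measurableSet_noise_bound (hc : 0 < lam * kappa B)
    (hk : Measurable (Function.uncurry (kern H : α → α → ℝ))) {δ : ℝ} (hδ0 : 0 < δ) (f : H)
    {Ω : Type*} [MeasurableSpace Ω] (μ : Measure Ω) [IsProbabilityMeasure μ]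
    {x : ℕ → Ω → α} (hx : ∀ i, Measurable (x i)) {y : ℕ → Ω → ℝ} (hy : ∀ i, Measurable (y i))
    (hy01 : ∀ i ω, y i ω = 0 ∨ y i ω = 1)
    (hdata : ∀ i, μ⟦{ω | y i ω = 1} | history x y i⟧ =ᵐ[μ] fun ω => Real.sigmoid (f (x i ω))) :
    ∃ E : Set Ω, MeasurableSet E ∧ 1 - δ ≤ μ.real E ∧ ∀ ω ∈ E, ∀ t : ℕ,
      2 * normVinv B lam (fun i : Fin t => x i ω)
        (∑ i : Fin t, (y i ω - Real.sigmoid (f (x i ω))) • feature H (x i ω)) ^ 2 ≤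
      Real.log (1 / δ) + (1 / 2) * Real.log ((1 : Matrix (Fin t) (Fin t) ℝ) +
        (lam * kappa B)⁻¹ • gram H (fun i : Fin t => x i ω)).det := by
  set q : ℕ → Ω → ℝ := fun i ω => Real.sigmoid (f (x i ω)) with hq
  set e : ℕ → Ω → ℝ := fun i ω => 2 * (y i ω - q i ω) with he
  set a : ℕ → Ω → ℝ := fun t ω => postCov (H := H) B lam (fun i : Fin t => x i ω) (x t ω) (x t ω)
  set b : ℕ → Ω → ℝ := fun t ω =>
    postMean B lam H (fun i : Fin t => x i ω) (fun i => e i ω) (x t ω) with hb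
  have hmono := history_mono (x := x) (y := y)
  have hqm {i t : ℕ} (h : i ≤ t) : Measurable[history x y t] (q i) :=
    continuous_sigmoid.measurable.comp
      ((measurable_apply hk f).comp (measurable_action_history h))
  -- The noise of round `t` enters only `history x y (t + 1)`, while the action `x t` already
  -- belongs to `history x y t`; hence `a t` and `b t` are known before `y t` is drawn.
  have hem {i t : ℕ} (h : i < t) : Measurable[history x y t] (e i) :=
    ((measurable_feedback_history h).sub (hqm h.le)).const_mul 2
  have ham (t : ℕ) : Measurable[history x y t] (a t) :=
    measurable_postCov hc hk (x := fun (i : Fin t) => x i)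
      (fun i => measurable_action_history i.2.le) (measurable_action_history le_rfl)
      (measurable_action_history le_rfl)
  have hbm (t : ℕ) : Measurable[history x y t] (b t) := by
    rw [hb]
    unfold postMean
    refine Finset.measurable_fun_sum _ fun i _ => (hem i.2).mul ?_
    exact measurable_postCov hc hk (x := fun (i : Fin t) => x i)
      (fun i => measurable_action_history i.2.le) (measurable_action_history le_rfl)
      (measurable_action_history i.2.le)
  have ha0 (t : ℕ) (ω : Ω) : 0 ≤ a t ω := postCov_self_nonneg _ hc _
  obtain ⟨E, hE, hμE, hprod⟩ := exists_measurableSet_prod_lt μ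
    (R := fun t ω => ENNReal.ofReal (mixtureStep (a t ω) (b t ω) (e t ω))) hmono
    (history_le hx hy) (fun t => by
      have h1 := (ham t).mono (hmono t.le_succ) le_rfl
      have h2 := (hbm t).mono (hmono t.le_succ) le_rfl
      have h3 := hem t.lt_succ_self
      refine Measurable.ennreal_ofReal ?_
      unfold mixtureStep
      fun_prop)
    (fun t G hG => lintegral_mul_mixtureStep_le (history_le hx hy t) (hy t) (hy01 t) (hqm le_rfl)
      (fun ω => Real.sigmoid_nonneg _) (fun ω => Real.sigmoid_le_one _) (hdata t) (ham t) (ha0 t)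
      (hbm t) hG)
    (c := ENNReal.ofReal (1 / δ)) (by simpa using hδ0) ENNReal.ofReal_ne_top
  refine ⟨E, hE, ?_, fun ω hω t => ?_⟩
  · have h1 : μ.real Eᶜ ≤ δ := by
      refine ENNReal.toReal_le_of_le_ofReal hδ0.le (hμE.trans (le_of_eq ?_))
      rw [one_div, one_div, ENNReal.ofReal_inv_of_pos hδ0, inv_inv]
    have h2 := probReal_compl_eq_one_sub (μ := μ) hE
    linarith
  · have h := hprod ω hω t
    rw [← ENNReal.ofReal_prod_of_nonneg fun i _ => (mixtureStep_pos (ha0 i ω) _ _).le,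
      ENNReal.ofReal_lt_ofReal_iff (by positivity)] at h
    rw [prod_mixtureStep_eq hc (fun i => x i ω) (fun i => e i ω)] at h
    have hdet := (one_add_gram_posDef (H := H) (fun i : Fin t => x i ω) (inv_pos.2 hc)).det_pos
    rw [div_lt_iff₀ (Real.sqrt_pos.2 hdet), ← Real.lt_log_iff_exp_lt (by positivity),
      Real.log_mul (by positivity) (by positivity), Real.log_sqrt hdet.le] at h
    -- Undoing the doubling turns the exponent `‖2 S‖² / 2` into `2 ‖S‖²`.
    have hS : ∑ i : Fin t, e i ω • feature H (x i ω) =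
        (2 : ℝ) • ∑ i : Fin t, (y i ω - q i ω) • feature H (x i ω) := by
      rw [Finset.smul_sum]
      simp only [he, mul_smul]
    rw [hS, normVinv_sq _ hc, map_smul, inner_smul_left, inner_smul_right, ← normVinv_sq _ hc,
      conj_trivial] at h
    linarith

end SelfNormalized

end LogisticCS

/-! ### The confidence sequence -/

theorem theorem1 {d : ℕ} (X : Set (EuclideanSpace ℝ (Fin d))) (hX : IsCompact X)
    {H : Type*} [NormedAddCommGroup H] [InnerProductSpace ℝ H] [CompleteSpace H] [RKHS ℝ H X ℝ]
    (hk_meas : Measurable (Function.uncurry (kern H : X → X → ℝ)))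
    (hk_le : ∀ z : X, kern H z z ≤ 1)
    (B lam δ : ℝ) (hlam : 0 < lam) (hδ0 : 0 < δ) (hδ1 : δ < 1)
    (f : H) (hf : ‖f‖ ≤ B)
    {Ω : Type*} [MeasurableSpace Ω] (μ : Measure Ω) [IsProbabilityMeasure μ]
    -- `x i` and `y i` are the action and the feedback of round `i + 1`
    (x : ℕ → Ω → X) (hx : ∀ i, Measurable (x i))
    (y : ℕ → Ω → ℝ) (hy : ∀ i, Measurable (y i))
    (hy01 : ∀ i ω, y i ω = 0 ∨ y i ω = 1)
    (hdata : ∀ i, μ⟦{ω | y i ω = 1} | history x y i⟧ =ᵐ[μ] fun ω => Real.sigmoid (f (x i ω))) :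
    -- the estimator is well defined and can be projected, for every realization of the data
    (∀ (t : ℕ) (ω : Ω), ∃! h : H,
      IsLogisticEstimator lam (fun i : Fin t => x i ω) (fun i : Fin t => y i ω) h) ∧
    (∀ (t : ℕ) (ω : Ω) (h : H),
      IsLogisticEstimator lam (fun i : Fin t => x i ω) (fun i : Fin t => y i ω) h →
      ∃ p : H, IsProjectedEstimator B lam (fun i : Fin t => x i ω) h p) ∧
    -- the confidence sequence
    ∃ E : Set Ω, MeasurableSet E ∧ 1 - δ ≤ μ.real E ∧
      ∀ ω ∈ E, ∀ (t : ℕ) (h : H),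
        IsLogisticEstimator lam (fun i : Fin t => x i ω) (fun i : Fin t => y i ω) h →
        (‖h‖ ≤ B → ∀ z : X, |Real.sigmoid (h z) - Real.sigmoid (f z)| ≤
          betaCoef H B lam δ t * postStd H B lam (fun i : Fin t => x i ω) z) ∧
        ∀ p : H, IsProjectedEstimator B lam (fun i : Fin t => x i ω) h p →
          (∀ z : X, |Real.sigmoid (p z) - Real.sigmoid (f z)| ≤
            betaCoef H B lam δ t * postStd H B lam (fun i : Fin t => x i ω) z) ∧
          ∀ q ∈ confSet B lam δ (fun i : Fin t => x i ω) p,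
            ∀ z : X, |Real.sigmoid (q z) - Real.sigmoid (f z)| ≤
              betaCoef H B lam δ t * postStd H B lam (fun i : Fin t => x i ω) z := by
  have hB : 0 ≤ B := (norm_nonneg f).trans hf
  have hc : 0 < lam * kappa B := mul_pos hlam (kappa_pos hB)
  refine ⟨fun t ω => existsUnique_isLogisticEstimator _ hlam fun i => hy01 i ω,
    fun t ω h hh => exists_isProjectedEstimator _ hB hlam hh, ?_⟩
  obtain ⟨E, hE, hμE, hnoise⟩ :=
    exists_measurableSet_noise_bound hc hk_meas hδ0 f μ hx hy hy01 hdata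
  refine ⟨E, hE, hμE, fun ω hω t h hh => ?_⟩
  have hgain := log_det_le_infoGain (H := H) lam (fun i : Fin t => x i ω) hk_le hB hlam
  have hbound := fun (p : H) (hp : IsProjectedEstimator B lam (fun i : Fin t => x i ω) h p)
      (q : H) => confidence_bounds_of_noise_bound (fun i : Fin t => x i ω) hk_le hlam hf hh
    ((hnoise ω hω t).trans (add_le_add le_rfl hgain)) hp (q := q)
  -- A nonnegative radius puts the projected estimator in its own confidence set.
  have hrad : 0 ≤ 2 * Real.sqrt (lam * kappa B) * B +
      kappa B * Real.sqrt (2 * Real.log (1 / δ) + 2 * infoGain H B lam t) := by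
    have := kappa_pos hB
    positivity
  have hself : ∀ p : H, IsProjectedEstimator B lam (fun i : Fin t => x i ω) h p → ∀ z : X,
      |Real.sigmoid (p z) - Real.sigmoid (f z)| ≤
        betaCoef H B lam δ t * postStd H B lam (fun i : Fin t => x i ω) z :=
    fun p hp => hbound p hp p hp.1 (by simpa [normV] using hrad)
  -- An estimator already in the ball is its own projection, since it makes the objective zero.
  refine ⟨fun hhB => hself h ⟨hhB, fun q _ => ?_⟩, fun p hp =>
    ⟨hself p hp, fun q hq => hbound p hp q hq.1 hq.2⟩⟩
  rw [sub_self]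
  simp [normVinv]
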